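/- Let $f:2^E\to\mathbb{R}_{\ge 0}$ be a monotone submodular function on a finite set $E$, that is, $f(S)\le f(T)$ for $S\subseteq T$ and $f(S)+f(T)\ge f(S\cup T)+f(S\cap T)$ for all $S,T\subseteq E$. Its curvature is $$\kappa_f = 1-\min_{S\subseteq E,\ e\in E\setminus S,\ f(\{e\})>0}\frac{f(S\cup\{e\})-f(S)}{f(\{e\})},$$ with $\kappa_f=0$ if $f(\{e\})=0$ for all $e\in E$. Theorem. For every $\varepsilon>0$ there are a deterministic algorithm and a polynomial $p$ (both depending on $\varepsilon$ only) such that the following holds for every $n$, every matroid $M$ on $E=\{0,\dots,n-1\}$ and every monotone submodular $f:2^E\to\mathbb{R}_{\ge 0}$. Given $n$, oracle access to the values of $f$ and oracle access to independence in $M$, the algorithm halts after at most $p(n)$ steps and outputs an independent set $S$ of $M$ with $$f(S)\ \ge\ \Bigl(1-\frac{\kappa_f}{e}-\varepsilon\Bigr)\max\{f(T) : T \text{ independent in } M\},$$ where $e$ here denotes Euler's number. The algorithm is not given $\kappa_f$. It is a program for a random access machine whose memory cells hold natural numbers, real numbers, or subsets of $E$; a step is the storing of a constant natural number, an addition, subtraction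 or comparison of two numbers, or an insertion, deletion or membership test of one element in a stored subset, while each union or difference of two stored subsets and each oracle query counts as $n+1$ steps. -/

import Mathlib

namespace OracleMax

/-! ### Set functions -/

/-- `f(S) + f(T) ≥ f(S ∪ T) + f(S ∩ T)` for all `S`, `T`. -/
def IsSubmodular {E : Type*} [DecidableEq E] (f : Finset E → ℝ) : Prop :=
  ∀ S T : Finset E, f (S ∪ T) + f (S ∩ T) ≤ f S + f T

/-- The curvature `κ_f = 1 - min (f(S + e) - f(S)) / f(e)`, the minimum being over all sets `S` and
elements `e ∉ S` with `f(e) ≠ 0` (so that the quotient makes sense). It is written as the maximum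
of `1 - (f(S + e) - f(S)) / f(e)`; if no element has a positive value, it is `0`. -/
noncomputable def curvature {E : Type*} [DecidableEq E] (f : Finset E → ℝ) : ℝ :=
  sSup {x : ℝ | ∃ (S : Finset E) (e : E), e ∉ S ∧ 0 < f {e} ∧
    x = 1 - (f (insert e S) - f S) / f {e}}

/-! ### Programs

A random access machine with access to a value oracle and an independence oracle. It has three
memories: cells holding natural numbers, cells holding real numbers, and cells holding subsets of
the ground set `Fin n` (bit vectors of length `n`). A program is a finite text which does not depend
on the instance, on `n`, or on any real constant. The numerical operations are addition,
subtraction and comparison only: there is no multiplication, division or rounding, hence a unit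
charge for them does not hide computations with numbers of superpolynomial length. Operations that
read whole subsets are charged `n + 1` steps. -/

/-- The address of a cell: cell number `k`, or the cell whose number is stored in the `k`-th cell
of the memory of natural numbers. -/
inductive Addr where
  | dir (k : ℕ)
  | ind (k : ℕ)

/-- Elementary instructions; the first address is that of the cell that is written. -/
inductive Instr where
  /-- store a constant -/
  | natConst (a : Addr) (k : ℕ)
  /-- sum of two natural numbers -/
  | natAdd (a b c : Addr)
  /-- truncated difference of two natural numbers -/
  | natSub (a b c : Addr)
  /-- sum of two real numbers -/
  | realAdd (a b c : Addr)
  /-- difference of two real numbers -/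
  | realSub (a b c : Addr)
  /-- insert the element whose index is stored in the natural number cell `i` -/
  | setInsert (a i : Addr)
  /-- remove the element whose index is stored in the natural number cell `i` -/
  | setErase (a i : Addr)
  /-- union of two sets -/
  | setUnion (a b c : Addr)
  /-- difference of two sets -/
  | setDiff (a b c : Addr)
  /-- query to the value oracle: store `f(S)` in the real cell `a`, for the set `S` in cell `b` -/
  | value (a b : Addr)

/-- Tests for branching. -/
inductive Test where
  /-- comparison of two natural numbers -/
  | natLt (a b : Addr)
  /-- comparison of two real numbers -/
  | realLt (a b : Addr)
  /-- does the element whose index is stored in the natural number cell `i` lie in the set? -/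
  | mem (i a : Addr)
  /-- query to the independence oracle of the matroid -/
  | indep (a : Addr)

/-- Programs. -/
inductive Program where
  | skip
  | instr (i : Instr)
  | seq (p q : Program)
  | ite (t : Test) (p q : Program)
  | loop (t : Test) (p : Program)

/-! ### Execution -/

/-- The contents of the memories. -/
structure State (n : ℕ) where
  nat : ℕ → ℕ
  real : ℕ → ℝ
  set : ℕ → Finset (Fin n)

/-- The initial state: the number `n` is in the natural number cell `0`, all else is empty. -/
noncomputable def State.init (n : ℕ) : State n where
  nat := Function.update (fun _ => 0) 0 n
  real := fun _ => 0
  set := fun _ => ∅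

/-- The output of a program is read off set cell `0`. -/
def State.output {n : ℕ} (s : State n) : Finset (Fin n) := s.set 0

/-- The number of the cell that an address denotes. -/
def Addr.eval {n : ℕ} (s : State n) : Addr → ℕ
  | .dir k => k
  | .ind k => s.nat k

namespace State

variable {n : ℕ}

/-- The natural number at an address. -/
def getNat (s : State n) (a : Addr) : ℕ := s.nat (a.eval s)

/-- The real number at an address. -/
def getReal (s : State n) (a : Addr) : ℝ := s.real (a.eval s)

/-- The set at an address. -/
def getSet (s : State n) (a : Addr) : Finset (Fin n) := s.set (a.eval s)

/-- Write a natural number. -/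
def putNat (s : State n) (a : Addr) (v : ℕ) : State n :=
  { s with nat := Function.update s.nat (a.eval s) v }

/-- Write a real number. -/
noncomputable def putReal (s : State n) (a : Addr) (v : ℝ) : State n :=
  { s with real := Function.update s.real (a.eval s) v }

/-- Write a set. -/
def putSet (s : State n) (a : Addr) (v : Finset (Fin n)) : State n :=
  { s with set := Function.update s.set (a.eval s) v }

end State

/-- The elements of the ground set with index `v`: one element if `v < n`, otherwise none. -/
def elems (n v : ℕ) : Finset (Fin n) := Finset.univ.filter (fun e => (e : ℕ) = v)

/-- The effect of an instruction, given the value oracle `f`. -/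
noncomputable def Instr.apply {n : ℕ} (f : Finset (Fin n) → ℝ) (s : State n) : Instr → State n
  | .natConst a k => s.putNat a k
  | .natAdd a b c => s.putNat a (s.getNat b + s.getNat c)
  | .natSub a b c => s.putNat a (s.getNat b - s.getNat c)
  | .realAdd a b c => s.putReal a (s.getReal b + s.getReal c)
  | .realSub a b c => s.putReal a (s.getReal b - s.getReal c)
  | .setInsert a i => s.putSet a (s.getSet a ∪ elems n (s.getNat i))
  | .setErase a i => s.putSet a (s.getSet a \ elems n (s.getNat i))
  | .setUnion a b c => s.putSet a (s.getSet b ∪ s.getSet c)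
  | .setDiff a b c => s.putSet a (s.getSet b \ s.getSet c)
  | .value a b => s.putReal a (f (s.getSet b))

/-- The number of steps charged for an instruction. -/
def Instr.cost (n : ℕ) : Instr → ℕ
  | .natConst _ _ => 1
  | .natAdd _ _ _ => 1
  | .natSub _ _ _ => 1
  | .realAdd _ _ _ => 1
  | .realSub _ _ _ => 1
  | .setInsert _ _ => 1
  | .setErase _ _ => 1
  | .setUnion _ _ _ => n + 1
  | .setDiff _ _ _ => n + 1
  | .value _ _ => n + 1

/-- The outcome of a test, given the matroid behind the independence oracle. -/
def Test.Holds {n : ℕ} (M : Matroid (Fin n)) (s : State n) : Test → Prop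
  | .natLt a b => s.getNat a < s.getNat b
  | .realLt a b => s.getReal a < s.getReal b
  | .mem i a => ∃ e ∈ s.getSet a, (e : ℕ) = s.getNat i
  | .indep a => M.Indep (s.getSet a : Set (Fin n))

/-- The number of steps charged for a test. -/
def Test.cost (n : ℕ) : Test → ℕ
  | .natLt _ _ => 1
  | .realLt _ _ => 1
  | .mem _ _ => 1
  | .indep _ => n + 1

/-- `Exec f M p s t s'`: with value oracle `f` and independence oracle of `M`, the program `p`,
started in state `s`, halts after exactly `t` steps in state `s'`. -/
inductive Exec {n : ℕ} (f : Finset (Fin n) → ℝ) (M : Matroid (Fin n)) :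
    Program → State n → ℕ → State n → Prop
  | skip (s : State n) : Exec f M .skip s 1 s
  | instr (i : Instr) (s : State n) : Exec f M (.instr i) s (i.cost n) (i.apply f s)
  | seq {p q : Program} {s s' s'' : State n} {t u : ℕ} :
      Exec f M p s t s' → Exec f M q s' u s'' → Exec f M (.seq p q) s (t + u) s''
  | iteTrue {b : Test} {p q : Program} {s s' : State n} {t : ℕ} :
      b.Holds M s → Exec f M p s t s' → Exec f M (.ite b p q) s (b.cost n + t) s'
  | iteFalse {b : Test} {p q : Program} {s s' : State n} {t : ℕ} :
      ¬ b.Holds M s → Exec f M q s t s' → Exec f M (.ite b p q) s (b.cost n + t) s'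
  | loopTrue {b : Test} {p : Program} {s s' s'' : State n} {t u : ℕ} :
      b.Holds M s → Exec f M p s t s' → Exec f M (.loop b p) s' u s'' →
      Exec f M (.loop b p) s (b.cost n + t + u) s''
  | loopFalse {b : Test} {p : Program} {s : State n} :
      ¬ b.Holds M s → Exec f M (.loop b p) s (b.cost n) s

/-- Programs are deterministic: the instance determines the running time and the final state. -/
theorem Exec.deterministic {n : ℕ} {f : Finset (Fin n) → ℝ} {M : Matroid (Fin n)} {p : Program}
    {s s₁ s₂ : State n} {t₁ t₂ : ℕ} (h₁ : Exec f M p s t₁ s₁) (h₂ : Exec f M p s t₂ s₂) :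
    t₁ = t₂ ∧ s₁ = s₂ := by
  induction h₁ generalizing t₂ s₂ with
  | skip s => cases h₂; exact ⟨rfl, rfl⟩
  | instr i s => cases h₂; exact ⟨rfl, rfl⟩
  | seq _ _ ih₁ ih₂ =>
    cases h₂ with
    | seq g₁ g₂ =>
      obtain ⟨rfl, rfl⟩ := ih₁ g₁
      obtain ⟨rfl, rfl⟩ := ih₂ g₂
      exact ⟨rfl, rfl⟩
  | iteTrue hb _ ih =>
    cases h₂ with
    | iteTrue _ g => obtain ⟨rfl, rfl⟩ := ih g; exact ⟨rfl, rfl⟩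
    | iteFalse hb' _ => exact absurd hb hb'
  | iteFalse hb _ ih =>
    cases h₂ with
    | iteTrue hb' _ => exact absurd hb' hb
    | iteFalse _ g => obtain ⟨rfl, rfl⟩ := ih g; exact ⟨rfl, rfl⟩
  | loopTrue hb _ _ ih₁ ih₂ =>
    cases h₂ with
    | loopTrue _ g₁ g₂ =>
      obtain ⟨rfl, rfl⟩ := ih₁ g₁
      obtain ⟨rfl, rfl⟩ := ih₂ g₂
      exact ⟨rfl, rfl⟩
    | loopFalse hb' => exact absurd hb hb'
  | loopFalse hb =>
    cases h₂ with
    | loopTrue hb' _ _ => exact absurd hb' hb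
    | loopFalse _ => exact ⟨rfl, rfl⟩

end OracleMax

/-!
The algorithm is a local search with the potential of Buchbinder and Feldman, to which a linear term
is added. Fix a constant `ℓ`. The search keeps a base `S` that is split into `ℓ` disjoint parts; a
move removes an element `u` of `S` from its part and inserts an element `v`, with `S - u + v`
independent (or `v = u`), into some part. For a set `J` of indices let `S_J` be the union of the
parts with index in `J`, and let `L` be the linear function with `L(e) = f(E) - f(E - e)`. The
potential is `∑_J weight |J| * f(S_J) + linWeight * L(S)`; it is a sum of constantly many values of
`f`, up to the linear term, hence it needs neither sampling nor knowledge of the curvature.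

Let `g = f - L`, which is again monotone and submodular. By symmetry (`sum_weight_sum`) all parts
have the same share of the weight, so that `ℓ` times the potential is
`ℓ * ∑_J weight |J| * g(S_J) + topWeight * L(S)` (`mul_potential`). Let `O` be independent. By Hall's
theorem there is an injection `h : O → S` such that each `o` can be exchanged for `h o`
(`exists_exchange_injection`). Add up the gains of the moves that put `o` into part `j` in place of
`h o`, over all `o` and `j`: submodularity bounds the total from below in terms of `g(O)` and the
`g(S_J)`, and the weights are such that everything cancels except for `J = ∅` and the set of all
indices (`sum_weight_telescope`). In a local optimum this gives `(1 - ρ) g(O) + L(O) ≤ f(S)`, where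
`ρ = (1 + 1/ℓ)^(-ℓ)` tends to `1/e` (`local_optimum`). As `L(O) ≥ (1 - κ_f) f(O)`, the left hand side
is at least `(1 - ρ κ_f) f(O)` (`local_optimum_ratio`).

For polynomial running time a move is carried out only if its gain exceeds `W / (n * C)`, where `W`
is the largest value of an independent singleton and `C` is a constant. The potential is at most a
constant times `n * W`, so a constant times `n ^ 2` rounds, each of which tries all moves, lead to a
configuration without such moves: otherwise each round would have increased the potential
(`SearchInv`). The loss due to the threshold is a small multiple of `W`, which is no more than the
optimum. All loops of the program are `for` loops over `0, …, n - 1`, nested to constant depth. Hence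
the program is written in a structured language `Code`, with a function `Code.run` as its
semantics, and one theorem, `Code.exec_compile`, provides both termination and the time bound.
-/

namespace OracleMax

/-! ### Structured programs -/

/-- Programs in which the only loops are `for` loops over the ground set: `forN i c` runs `c` with
the natural number cell `i` going through `0, …, n - 1`. -/
inductive Code where
  | skip
  | instr (i : Instr)
  | seq (c d : Code)
  | ite (t : Test) (c d : Code)
  | forN (i : ℕ) (c : Code)

namespace Code

/-- Add one to the natural number cell `i`; cell `1` is used to hold the constant `1`. -/
noncomputable def incr {n : ℕ} (i : ℕ) (s : State n) : State n :=
  (s.putNat (.dir 1) 1).putNat (.dir i) ((s.putNat (.dir 1) 1).nat i + 1)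

/-- Set the natural number cell `i` to `0`. -/
noncomputable def reset {n : ℕ} (i : ℕ) (s : State n) : State n :=
  s.putNat (.dir i) 0

/-- The program for the random access machine. -/
def compile : Code → Program
  | skip => .skip
  | instr i => .instr i
  | seq c d => .seq c.compile d.compile
  | ite t c d => .ite t c.compile d.compile
  | forN i c => .seq (.instr (.natConst (.dir i) 0)) (.loop (.natLt (.dir i) (.dir 0))
      (.seq c.compile (.seq (.instr (.natConst (.dir 1) 1))
        (.instr (.natAdd (.dir i) (.dir i) (.dir 1))))))

open Classical in
/-- The state that results from running the code; this agrees with the execution of the compiled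
program when `WellFormed` holds and cell `0` contains `n`. -/
noncomputable def run {n : ℕ} (f : Finset (Fin n) → ℝ) (M : Matroid (Fin n)) :
    Code → State n → State n
  | skip, s => s
  | instr i, s => i.apply f s
  | seq c d, s => run f M d (run f M c s)
  | ite t c d, s => if t.Holds M s then run f M c s else run f M d s
  | forN i c, s => (fun s => incr i (run f M c s))^[n] (reset i s)

/-- A polynomial bound for the running time. -/
noncomputable def time : Code → Polynomial ℕ
  | skip => 1
  | instr _ => .X + 1
  | seq c d => c.time + d.time
  | ite _ c d => .X + 1 + (c.time + d.time)
  | forN _ c => 2 + .X * (3 + c.time)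

/-- The code does not write the natural number cell `k`. Only the counters of loops, and the
auxiliary cell `1`, are ever written. -/
def Keeps (k : ℕ) : Code → Prop
  | skip => True
  | instr (.natConst _ _) => False
  | instr (.natAdd _ _ _) => False
  | instr (.natSub _ _ _) => False
  | instr _ => True
  | seq c d => c.Keeps k ∧ d.Keeps k
  | ite _ c d => c.Keeps k ∧ d.Keeps k
  | forN i c => k ≠ i ∧ k ≠ 1 ∧ c.Keeps k

/-- Loop counters are not tampered with inside the loops, and cell `0`, which holds `n`, is never
written. -/
def WellFormed : Code → Prop
  | skip => True
  | instr i => (instr i).Keeps 0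
  | seq c d => c.WellFormed ∧ d.WellFormed
  | ite _ c d => c.WellFormed ∧ d.WellFormed
  | forN i c => i ≠ 0 ∧ i ≠ 1 ∧ c.Keeps i ∧ c.WellFormed

variable {n : ℕ} {f : Finset (Fin n) → ℝ} {M : Matroid (Fin n)}

theorem run_seq (c d : Code) (s : State n) : run f M (seq c d) s = run f M d (run f M c s) := rfl

theorem run_instr (i : Instr) (s : State n) : run f M (instr i) s = i.apply f s := rfl

theorem run_skip (s : State n) : run f M skip s = s := rfl

theorem run_ite_pos {t : Test} {s : State n} (h : t.Holds M s) (c d : Code) :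
    run f M (ite t c d) s = run f M c s := if_pos h

theorem run_ite_neg {t : Test} {s : State n} (h : ¬ t.Holds M s) (c d : Code) :
    run f M (ite t c d) s = run f M d s := if_neg h

theorem run_nat {k : ℕ} (c : Code) (hc : c.Keeps k) (s : State n) :
    (run f M c s).nat k = s.nat k := by
  induction c generalizing s with
  | skip => rfl
  | instr i => cases i <;> first | exact hc.elim | rfl
  | seq c d ihc ihd => simp only [run]; rw [ihd hc.2, ihc hc.1]
  | ite t c d ihc ihd =>
    simp only [run]
    split_ifs
    exacts [ihc hc.1 s, ihd hc.2 s]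
  | forN i c ih =>
    obtain ⟨h₁, h₂, h₃⟩ := hc
    simp only [run]
    have : ∀ m (s : State n), ((fun s => incr i (run f M c s))^[m] s).nat k = s.nat k := by
      intro m
      induction m with
      | zero => intro s; rfl
      | succ m ihm =>
        intro s
        rw [Function.iterate_succ_apply, ihm]
        simp [incr, State.putNat, Addr.eval, h₁, h₂, ih h₃]
    rw [this]
    simp [reset, State.putNat, Addr.eval, h₁]

theorem WellFormed.keeps_zero {c : Code} (hc : c.WellFormed) : c.Keeps 0 := by
  induction c with
  | skip => trivial
  | instr i => exact hc
  | seq c d ihc ihd => exact ⟨ihc hc.1, ihd hc.2⟩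
  | ite t c d ihc ihd => exact ⟨ihc hc.1, ihd hc.2⟩
  | forN i c ih => exact ⟨hc.1.symm, zero_ne_one, ih hc.2.2.2⟩

theorem cost_le (i : Instr) : i.cost n ≤ n + 1 := by cases i <;> simp [Instr.cost]

theorem test_cost_le (t : Test) : t.cost n ≤ n + 1 := by cases t <;> simp [Test.cost]

/-- The compiled program halts in the state computed by `run`, within time `time`. -/
theorem exec_compile (c : Code) (hc : c.WellFormed) (s : State n) (hs : s.nat 0 = n) :
    ∃ t, t ≤ c.time.eval n ∧ Exec f M c.compile s t (run f M c s) := by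
  classical
  induction c generalizing s with
  | skip => exact ⟨1, by simp [time], .skip s⟩
  | instr i => exact ⟨_, by simpa [time] using cost_le i, .instr i s⟩
  | seq c d ihc ihd =>
    obtain ⟨a, ha, hca⟩ := ihc hc.1 s hs
    obtain ⟨b, hb, hdb⟩ := ihd hc.2 (run f M c s) ((run_nat c hc.1.keeps_zero s).trans hs)
    exact ⟨a + b, by simp [time]; omega, .seq hca hdb⟩
  | ite t c d ihc ihd =>
    simp only [run, time, Polynomial.eval_add, Polynomial.eval_X, Polynomial.eval_one]
    have := test_cost_le (n := n) t
    split_ifs with h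
    · obtain ⟨a, ha, hca⟩ := ihc hc.1 s hs
      exact ⟨_, by omega, .iteTrue h hca⟩
    · obtain ⟨a, ha, hca⟩ := ihd hc.2 s hs
      exact ⟨_, by omega, .iteFalse h hca⟩
  | forN i c ih =>
    obtain ⟨h0, h1, ki, hw⟩ := hc
    have k0 := hw.keeps_zero
    have key : ∀ m (s : State n), s.nat 0 = n → s.nat i + m = n →
        ∃ t, t ≤ 1 + m * (3 + c.time.eval n) ∧
          Exec f M (.loop (.natLt (.dir i) (.dir 0)) (.seq c.compile
            (.seq (.instr (.natConst (.dir 1) 1))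
              (.instr (.natAdd (.dir i) (.dir i) (.dir 1)))))) s t
            ((fun s => incr i (run f M c s))^[m] s) := by
      intro m
      induction m with
      | zero =>
        intro s hs hi
        exact ⟨1, by simp, .loopFalse (by simp [Test.Holds, State.getNat, Addr.eval]; omega)⟩
      | succ m ihm =>
        intro s hs hi
        obtain ⟨a, ha, hca⟩ := ih hw s hs
        have e0 := run_nat (f := f) (M := M) c k0 s
        have ei := run_nat (f := f) (M := M) c ki s
        obtain ⟨b, hb, hcb⟩ := ihm (incr i (run f M c s))
          (by simp [incr, State.putNat, Addr.eval, h0.symm, e0, hs])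
          (by simp [incr, State.putNat, Addr.eval, h1, ei]; omega)
        have hstep := Exec.seq hca (Exec.seq (Exec.instr (.natConst (.dir 1) 1) _)
          (Exec.instr (.natAdd (.dir i) (.dir i) (.dir 1)) _))
        have heq : Instr.apply f (Instr.apply f (run f M c s) (.natConst (.dir 1) 1))
            (.natAdd (.dir i) (.dir i) (.dir 1)) = incr i (run f M c s) := by
          simp [Instr.apply, State.putNat, State.getNat, Addr.eval, incr]
        rw [heq] at hstep
        refine ⟨_, ?_, .loopTrue (by simp [Test.Holds, State.getNat, Addr.eval]; omega)
          hstep hcb⟩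
        simp only [Test.cost, Instr.cost]
        nlinarith
    obtain ⟨t, ht, hex⟩ := key n (reset i s)
      (by simp [reset, State.putNat, Addr.eval, h0.symm, hs])
      (by simp [reset, State.putNat, Addr.eval])
    refine ⟨_, ?_, .seq (.instr _ s) hex⟩
    simp only [time, Instr.cost, Polynomial.eval_add, Polynomial.eval_mul, Polynomial.eval_X,
      Polynomial.eval_ofNat]
    omega

/-- Invariant rule for `for` loops. -/
theorem forN_induction {i : ℕ} {c : Code} (hi : i ≠ 1) (hc : c.Keeps i)
    (I : ℕ → State n → Prop) {s : State n} (h0 : I 0 (reset i s))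
    (hstep : ∀ k < n, ∀ s, s.nat i = k → I k s → I (k + 1) (incr i (run f M c s))) :
    I n (run f M (.forN i c) s) := by
  have key : ∀ m ≤ n, I m ((fun s => incr i (run f M c s))^[m] (reset i s)) ∧
      ((fun s => incr i (run f M c s))^[m] (reset i s)).nat i = m := by
    intro m
    induction m with
    | zero => intro _; exact ⟨h0, by simp [reset, State.putNat, Addr.eval]⟩
    | succ m ih =>
      intro hm
      obtain ⟨h₁, h₂⟩ := ih (by omega)
      rw [Function.iterate_succ_apply']
      refine ⟨hstep m (by omega) _ h₂ h₁, ?_⟩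
      generalize (fun s => incr i (run f M c s))^[m] (reset i s) = s' at h₂
      simp [incr, State.putNat, Addr.eval, hi, run_nat c hc, h₂]
  exact (key n le_rfl).1

/-- Sequential composition of a list. -/
def block (l : List Code) : Code := l.foldr .seq .skip

/-- Composition of `k` copies. -/
def rep (k : ℕ) (c : Code) : Code := block (List.replicate k c)

@[simp] theorem run_block_nil (s : State n) : run f M (block []) s = s := rfl

@[simp] theorem run_block_cons (c : Code) (l : List Code) (s : State n) :
    run f M (block (c :: l)) s = run f M (block l) (run f M c s) := rfl

@[simp] theorem run_rep_zero (c : Code) (s : State n) : run f M (rep 0 c) s = s := rfl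

theorem run_rep_succ (k : ℕ) (c : Code) (s : State n) :
    run f M (rep (k + 1) c) s = run f M (rep k c) (run f M c s) := rfl

theorem keeps_block {k : ℕ} {l : List Code} : (block l).Keeps k ↔ ∀ c ∈ l, c.Keeps k := by
  induction l with
  | nil => simp [block, Keeps]
  | cons c l ih => simpa [block, Keeps] using fun _ => ih

theorem wellFormed_block {l : List Code} : (block l).WellFormed ↔ ∀ c ∈ l, c.WellFormed := by
  induction l with
  | nil => simp [block, WellFormed]
  | cons c l ih => simpa [block, WellFormed] using fun _ => ih

theorem keeps_rep {k m : ℕ} {c : Code} (hc : c.Keeps k) : (rep m c).Keeps k :=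
  keeps_block.2 fun _ h => (List.eq_of_mem_replicate h) ▸ hc

theorem wellFormed_rep {m : ℕ} {c : Code} (hc : c.WellFormed) : (rep m c).WellFormed :=
  wellFormed_block.2 fun _ h => (List.eq_of_mem_replicate h) ▸ hc

/-- Invariant rule for a block that treats the elements of a finite set one by one. -/
theorem block_induction {α : Type*} [DecidableEq α] (A : Finset α) (c : α → Code)
    (I : Finset α → State n → Prop) {s : State n} (h0 : I ∅ s)
    (hstep : ∀ B, ∀ a ∈ A, a ∉ B → ∀ s, I B s → I (insert a B) (run f M (c a) s)) :
    I A (run f M (block (A.toList.map c)) s) := by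
  have key : ∀ (l : List α) (B : Finset α) (s : State n), l.Nodup → (∀ a ∈ l, a ∈ A ∧ a ∉ B) →
      I B s → I (B ∪ l.toFinset) (run f M (block (l.map c)) s) := by
    intro l
    induction l with
    | nil => intro B s _ _ h; simpa using h
    | cons a l ih =>
      intro B s hl hA h
      rw [List.nodup_cons] at hl
      have := ih (insert a B) (run f M (c a) s) hl.2
        (fun b hb => ⟨(hA b (by simp [hb])).1, by
          simp only [Finset.mem_insert, not_or]
          exact ⟨fun e => hl.1 (e ▸ hb), (hA b (by simp [hb])).2⟩⟩)
        (hstep B a (hA a (by simp)).1 (hA a (by simp)).2 s h)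
      simpa [Finset.insert_union, Finset.union_insert] using this
  have := key A.toList ∅ s A.nodup_toList (by simp) h0
  simpa using this

end Code

open Finset

/-! ### Weights -/

/-- The weight of a set of `k` parts in the potential, up to a common factor the rational number
`(1 + 1/ℓ)^(k-1) / binom (ℓ-1) (k-1)`; the weight of the empty set is `0`. -/
def weight (ℓ : ℕ) : ℕ → ℕ
  | 0 => 0
  | k + 1 => (ℓ + 1) ^ k * ℓ ^ (ℓ - 1 - k) * k.factorial * (ℓ - 1 - k).factorial

/-- The coefficient of the linear term in the potential; it belongs to the scaling by which the
weights are natural numbers. -/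
def linWeight (ℓ : ℕ) : ℕ := ℓ ^ ℓ * (ℓ - 1).factorial

/-- The coefficient of the value of the union of all parts in `sum_weight_telescope`. -/
def topWeight (ℓ : ℕ) : ℕ := ℓ * (ℓ + 1) ^ ℓ * (ℓ - 1).factorial

theorem weight_succ {ℓ k : ℕ} (hk : 0 < k) (hkl : k < ℓ) :
    ℓ * ((ℓ - k) * weight ℓ (k + 1)) = (ℓ + 1) * (k * weight ℓ k) := by
  obtain ⟨k, rfl⟩ : ∃ m, k = m + 1 := ⟨k - 1, by omega⟩
  obtain ⟨d, rfl⟩ : ∃ d, ℓ = k + 1 + (d + 1) := ⟨ℓ - k - 2, by omega⟩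
  have h1 : k + 1 + (d + 1) - 1 - (k + 1) = d := by omega
  have h2 : k + 1 + (d + 1) - 1 - k = d + 1 := by omega
  have h3 : k + 1 + (d + 1) - (k + 1) = d + 1 := by omega
  simp only [weight, h1, h2, h3, Nat.factorial_succ, pow_succ]
  ring

theorem weight_self {ℓ : ℕ} (hl : 0 < ℓ) : (ℓ + 1) * (ℓ * weight ℓ ℓ) = topWeight ℓ := by
  obtain ⟨k, rfl⟩ : ∃ m, ℓ = m + 1 := ⟨ℓ - 1, by omega⟩
  simp [weight, topWeight, pow_succ]
  ring

theorem weight_one {ℓ : ℕ} (hl : 0 < ℓ) : ℓ * weight ℓ 1 = linWeight ℓ := by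
  obtain ⟨k, rfl⟩ : ∃ m, ℓ = m + 1 := ⟨ℓ - 1, by omega⟩
  simp [weight, linWeight, pow_succ]
  ring

theorem sum_erase_weight {ι : Type*} [DecidableEq ι] (U : Finset ι) (w : ℕ → ℝ)
    (s : Finset ι → ℝ) :
    ∑ J ∈ U.powerset, w #J * ∑ i ∈ J, s (J.erase i) =
      ∑ J ∈ U.powerset, ((#U : ℝ) - #J) * w (#J + 1) * s J := by
  have h : ∀ J ∈ U.powerset, ((#U : ℝ) - #J) * w (#J + 1) * s J =
      ∑ i ∈ U \ J, w (#J + 1) * s J := by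
    intro J hJ
    rw [sum_const, card_sdiff_of_subset (mem_powerset.1 hJ), nsmul_eq_mul,
      Nat.cast_sub (card_le_card (mem_powerset.1 hJ)), mul_assoc]
  rw [sum_congr rfl h]
  simp_rw [mul_sum]
  rw [sum_sigma', sum_sigma']
  refine sum_nbij' (fun p => ⟨p.1.erase p.2, p.2⟩) (fun p => ⟨insert p.2 p.1, p.2⟩) ?_ ?_ ?_ ?_ ?_
  · rintro ⟨J, i⟩ h
    simp only [mem_sigma, mem_powerset, mem_sdiff] at h ⊢
    exact ⟨(erase_subset _ _).trans h.1, h.1 h.2, notMem_erase _ _⟩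
  · rintro ⟨J, i⟩ h
    simp only [mem_sigma, mem_powerset, mem_sdiff] at h ⊢
    exact ⟨insert_subset h.2.1 h.1, mem_insert_self _ _⟩
  · rintro ⟨J, i⟩ h
    simp only [mem_sigma] at h
    simp [insert_erase h.2]
  · rintro ⟨J, i⟩ h
    simp only [mem_sigma, mem_sdiff] at h
    simp [erase_insert h.2.2]
  · rintro ⟨J, i⟩ h
    simp only [mem_sigma] at h
    simp only
    rw [card_erase_add_one h.2]

/-- The weights are chosen such that in this sum the contributions of all sets of parts cancel,
except for those of the empty set and of the set of all parts. -/
theorem sum_weight_telescope {ℓ : ℕ} (hl : 0 < ℓ) (s : Finset ℕ → ℝ) :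
    ℓ * ∑ J ∈ (range ℓ).powerset, (weight ℓ #J : ℝ) * ∑ i ∈ J, (s J - s (J.erase i)) +
      ∑ J ∈ (range ℓ).powerset, (weight ℓ #J * #J : ℝ) * s J =
    topWeight ℓ * s (range ℓ) - ℓ * linWeight ℓ * s ∅ := by
  have h1 : ∀ J : Finset ℕ, (weight ℓ #J : ℝ) * ∑ i ∈ J, (s J - s (J.erase i)) =
      (weight ℓ #J : ℝ) * #J * s J - (weight ℓ #J : ℝ) * ∑ i ∈ J, s (J.erase i) := by
    intro J
    rw [sum_sub_distrib, sum_const, nsmul_eq_mul]; ring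
  simp_rw [h1]
  rw [sum_sub_distrib, sum_erase_weight _ (fun k => (weight ℓ k : ℝ)), card_range,
    ← sum_sub_distrib, mul_sum, ← sum_add_distrib]
  have hne : (∅ : Finset ℕ) ≠ range ℓ := by
    intro h
    have := congrArg card h
    simp at this; omega
  have h2 : ∀ J ∈ (range ℓ).powerset, J ≠ ∅ ∧ J ≠ range ℓ →
      (ℓ : ℝ) * ((weight ℓ #J : ℝ) * #J * s J - ((ℓ : ℝ) - #J) * weight ℓ (#J + 1) * s J) +
        (weight ℓ #J * #J : ℝ) * s J = 0 := by
    intro J hJ hJ2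
    have hc := card_lt_card (Finset.ssubset_iff_subset_ne.2 ⟨mem_powerset.1 hJ, hJ2.2⟩)
    rw [card_range] at hc
    have := weight_succ (card_pos.2 (nonempty_iff_ne_empty.2 hJ2.1)) hc
    have h3 : (ℓ : ℝ) * (((ℓ : ℝ) - #J) * weight ℓ (#J + 1)) = (ℓ + 1) * (#J * weight ℓ #J) := by
      rw [← Nat.cast_sub hc.le]; exact_mod_cast this
    linear_combination (-s J) * h3
  rw [← sum_subset (s₁ := {∅, range ℓ}) (by intro J hJ; simp at hJ; rcases hJ with rfl | rfl <;> simp)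
    (fun J hJ hJ2 => h2 J hJ (by simpa using hJ2)), sum_pair hne]
  have e1 : (ℓ + 1) * (ℓ * weight ℓ ℓ : ℝ) = topWeight ℓ := by exact_mod_cast weight_self hl
  have e2 : (ℓ * weight ℓ 1 : ℝ) = linWeight ℓ := by exact_mod_cast weight_one hl
  have e3 : (weight ℓ 0 : ℝ) = 0 := by simp [weight]
  simp only [card_empty, card_range, zero_add, e3, Nat.cast_zero]
  linear_combination s (range ℓ) * e1 - (ℓ : ℝ) * s ∅ * e2

theorem sum_weight_card {ℓ : ℕ} (hl : 0 < ℓ) :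
    ∑ J ∈ (range ℓ).powerset, (weight ℓ #J * #J : ℝ) = topWeight ℓ - ℓ * linWeight ℓ := by
  simpa using sum_weight_telescope hl (fun _ => 1)

/-- By symmetry every part has the same share of the total weight. -/
theorem sum_weight_sum {ℓ : ℕ} (hl : 0 < ℓ) (a : ℕ → ℝ) :
    ℓ * ∑ J ∈ (range ℓ).powerset, (weight ℓ #J : ℝ) * ∑ i ∈ J, a i =
      (topWeight ℓ - ℓ * linWeight ℓ) * ∑ i ∈ range ℓ, a i := by
  obtain ⟨c, hc⟩ : ∃ c : ℝ, ∀ i ∈ range ℓ,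
      ∑ J ∈ (range ℓ).powerset, (if i ∈ J then (weight ℓ #J : ℝ) else 0) = c := by
    refine ⟨∑ m ∈ range (ℓ - 1 + 1), ((ℓ - 1).choose m) • (weight ℓ (m + 1) : ℝ), fun i hi => ?_⟩
    have hU : range ℓ = insert i ((range ℓ).erase i) := (insert_erase hi).symm
    have hcard : #((range ℓ).erase i) = ℓ - 1 := by rw [card_erase_of_mem hi, card_range]
    rw [hU, sum_powerset_insert (notMem_erase _ _), sum_eq_zero, zero_add, ← hcard,
      ← sum_powerset_apply_card (fun m => (weight ℓ (m + 1) : ℝ))]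
    · refine sum_congr rfl fun J hJ => ?_
      rw [if_pos (mem_insert_self _ _), card_insert_of_notMem]
      exact fun h => notMem_erase i _ (mem_powerset.1 hJ h)
    · intro J hJ
      rw [if_neg]
      exact fun h => notMem_erase i _ (mem_powerset.1 hJ h)
  have hswap : ∀ b : ℕ → ℝ, ∑ J ∈ (range ℓ).powerset, (weight ℓ #J : ℝ) * ∑ i ∈ J, b i =
      c * ∑ i ∈ range ℓ, b i := by
    intro b
    rw [mul_sum, ← sum_congr rfl (fun i hi => by rw [← hc i hi, sum_mul] :
      ∀ i ∈ range ℓ, (∑ J ∈ (range ℓ).powerset,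
        (if i ∈ J then (weight ℓ #J : ℝ) else 0) * b i) = c * b i), sum_comm]
    refine sum_congr rfl fun J hJ => ?_
    simp_rw [ite_mul, zero_mul]
    rw [sum_ite_mem, inter_eq_right.2 (mem_powerset.1 hJ), mul_sum]
  have h1 := hswap (fun _ => 1)
  simp only [sum_const, nsmul_eq_mul, mul_one, card_range] at h1
  rw [sum_weight_card hl] at h1
  rw [hswap, h1]; ring

/-! ### Submodular functions -/

section Submodular

variable {E : Type*} [DecidableEq E] {g : Finset E → ℝ}

theorem IsSubmodular.insert_sub_le (hg : IsSubmodular g) (hm : Monotone g) {A B : Finset E}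
    (hBA : B ⊆ A) (e : E) : g (insert e A) - g A ≤ g (insert e B) - g B := by
  by_cases he : e ∈ A
  · rw [insert_eq_of_mem he]
    have := hm (subset_insert e B)
    simp only [sub_self]; linarith
  · have := hg (insert e B) A
    have h1 : insert e B ∪ A = insert e A := by
      rw [insert_union, union_eq_right.2 hBA]
    have h2 : insert e B ∩ A = B := by
      rw [insert_inter_of_notMem he, inter_eq_left.2 hBA]
    rw [h1, h2] at this; linarith

theorem IsSubmodular.union_sub_le (hg : IsSubmodular g) (hm : Monotone g) (A O : Finset E) :
    g (O ∪ A) - g A ≤ ∑ o ∈ O, (g (insert o A) - g A) := by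
  induction O using Finset.induction_on with
  | empty => simp
  | insert o O ho ih =>
    rw [sum_insert ho, insert_union]
    have := hg.insert_sub_le hm (subset_union_right : A ⊆ O ∪ A) o
    linarith

theorem IsSubmodular.sum_sub_erase_le (hg : IsSubmodular g) (hm : Monotone g) (X A : Finset E) :
    ∑ u ∈ A, (g X - g (X.erase u)) ≤ g X - g (X \ A) := by
  induction A using Finset.induction_on with
  | empty => simp
  | insert u A hu ih =>
    rw [sum_insert hu]
    have h1 : X \ insert u A = (X \ A).erase u := by rw [sdiff_insert]
    rw [h1]
    by_cases hx : u ∈ X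
    · have h2 := hg.insert_sub_le hm (erase_subset_erase u (sdiff_subset : X \ A ⊆ X)) u
      rw [insert_erase hx, insert_erase (mem_sdiff.2 ⟨hx, hu⟩)] at h2
      linarith
    · rw [erase_eq_of_notMem hx, erase_eq_of_notMem (fun h => hx (mem_sdiff.1 h).1)]
      linarith

theorem IsSubmodular.le_sum_singleton (hg : IsSubmodular g) (hm : Monotone g) (h0 : 0 ≤ g ∅)
    {S : Finset E} (hS : S.Nonempty) : g S ≤ ∑ e ∈ S, g {e} := by
  have h := hg.union_sub_le hm ∅ S
  simp only [union_empty, insert_empty, sum_sub_distrib, sum_const, nsmul_eq_mul] at h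
  have : (1 : ℝ) ≤ #S := by exact_mod_cast hS.card_pos
  nlinarith

end Submodular

/-! ### Exchanges in matroids -/

/-- The elements of an independent set `O` can be matched with distinct elements of a base `S` so
that each matched pair can be exchanged. This is Hall's theorem, applied to the fundamental
circuits of the elements of `O`; elements of `O ∩ S` are matched with themselves. -/
theorem exists_exchange_injection {E : Type*} [DecidableEq E] {M : Matroid E} {S O : Finset E}
    (hE : M.E = Set.univ) (hS : M.IsBase (S : Set E)) (hO : M.Indep (O : Set E)) :
    ∃ h : E → E, Set.InjOn h O ∧ ∀ o ∈ O, h o ∈ S ∧ o ∉ S.erase (h o) ∧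
      M.Indep (insert o (S.erase (h o)) : Finset E) := by
  classical
  let t : O → Finset E := fun o => S.filter fun u => (o : E) ∉ S.erase u ∧
    M.Indep (insert (o : E) (S.erase u) : Finset E)
  have ht : ∀ (o : O) (N : Finset E), t o ⊆ N → (o : E) ∈ M.closure N := by
    intro o N hN
    by_cases ho : (o : E) ∈ S
    · have : (o : E) ∈ t o := by
        simp only [t, mem_filter, notMem_erase, not_false_eq_true, true_and, insert_erase ho]
        exact ⟨ho, hS.indep⟩
      exact M.mem_closure_of_mem (mem_coe.2 (hN this)) (by rw [hE]; exact Set.subset_univ _)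
    · have hcl : (o : E) ∈ M.closure S := by rw [hS.closure_eq, hE]; trivial
      have hC := hS.indep.fundCircuit_isCircuit hcl (by simpa using ho)
      refine M.closure_subset_closure ?_
        (hC.mem_closure_sdiff_singleton_of_mem (M.mem_fundCircuit _ _))
      rintro x ⟨hx, hxo⟩
      refine hN ?_
      have hxS : x ∈ S := by
        rcases M.fundCircuit_subset_insert _ _ hx with h | h
        · exact absurd h hxo
        · exact h
      rw [hS.indep.mem_fundCircuit_iff hcl (by simpa using ho)] at hx
      simp only [t, mem_filter]
      refine ⟨hxS, fun h => ho (mem_of_mem_erase h), ?_⟩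
      rw [coe_insert, coe_erase, Set.insert_sdiff_singleton_comm]
      · exact hx
      · exact fun h => hxo h.symm
  obtain ⟨h, hinj, hmem⟩ := (Finset.all_card_le_biUnion_card_iff_exists_injective t).1 (by
    intro X
    have h1 : M.Indep ((X.map (Function.Embedding.subtype _) : Finset E) : Set E) :=
      hO.subset (by intro x hx; simp at hx; exact hx.1)
    have h2 : ((X.map (Function.Embedding.subtype _) : Finset E) : Set E) ⊆
        M.closure (X.biUnion t : Finset E) := by
      intro x hx
      simp only [coe_map, Set.mem_image, mem_coe] at hx
      obtain ⟨o, ho, rfl⟩ := hx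
      exact ht o _ (subset_biUnion_of_mem t ho)
    have h3 := (h1.encard_le_eRk_of_subset h2).trans
      ((M.eRk_closure_eq _).trans_le (M.eRk_le_encard _))
    rw [Set.encard_coe_eq_coe_finsetCard, Set.encard_coe_eq_coe_finsetCard, card_map] at h3
    exact_mod_cast h3)
  refine ⟨fun e => if he : e ∈ O then h ⟨e, he⟩ else e, ?_, fun o ho => ?_⟩
  · intro a ha b hb hab
    simp only [mem_coe] at ha hb
    simp only [dif_pos ha, dif_pos hb] at hab
    exact congrArg Subtype.val (hinj hab)
  · have := hmem ⟨o, ho⟩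
    simpa only [dif_pos ho, t, mem_filter] using this

/-! ### Splitting off the linear part -/

section Linear

variable {E : Type*} [DecidableEq E] [Fintype E] {f : Finset E → ℝ}

/-- The least marginal value of an element, which is the coefficient of this element in the linear
part of `f`. -/
def lin (f : Finset E → ℝ) (e : E) : ℝ := f univ - f (univ.erase e)

/-- What remains of `f` after its linear part is split off. -/
def nonlin (f : Finset E → ℝ) (S : Finset E) : ℝ := f S - ∑ e ∈ S, lin f e

theorem lin_nonneg (hm : Monotone f) (e : E) : 0 ≤ lin f e :=
  sub_nonneg.2 (hm (erase_subset _ _))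

theorem lin_le (hf : IsSubmodular f) (hm : Monotone f) {e : E} {S : Finset E} (he : e ∉ S) :
    lin f e ≤ f (insert e S) - f S := by
  have h := hf.insert_sub_le hm (A := univ.erase e) (B := S)
    (fun x hx => mem_erase.2 ⟨fun h => he (h ▸ hx), mem_univ _⟩) e
  rwa [insert_erase (mem_univ _)] at h

theorem monotone_nonlin (hf : IsSubmodular f) (hm : Monotone f) : Monotone (nonlin f) := by
  have key : ∀ S D : Finset E, nonlin f S ≤ nonlin f (D ∪ S) := by
    intro S D
    induction D using Finset.induction_on with
    | empty => simp
    | insert e D he ih =>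
      refine ih.trans ?_
      rw [insert_union]
      by_cases h : e ∈ D ∪ S
      · rw [insert_eq_of_mem h]
      · have := lin_le hf hm h
        simp only [nonlin, sum_insert h]
        linarith
  intro S T hST
  have := key S T
  rwa [union_eq_left.2 hST] at this

theorem isSubmodular_nonlin (hf : IsSubmodular f) : IsSubmodular (nonlin f) := by
  intro S T
  have h1 := hf S T
  have h2 := sum_union_inter (s₁ := S) (s₂ := T) (f := lin f)
  simp only [nonlin]
  linarith

end Linear

/-! ### Local search -/

section LocalSearch

variable {E : Type*} [DecidableEq E]

/-- The configuration obtained from the parts `x` by removing `u` from its part and inserting `v`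
into the part with index `j`. -/
def move (x : ℕ → Finset E) (u v : E) (j i : ℕ) : Finset E :=
  if i = j then insert v ((x i).erase u) else (x i).erase u

theorem biUnion_move (x : ℕ → Finset E) (u v : E) (j : ℕ) (J : Finset ℕ) :
    J.biUnion (move x u v j) =
      if j ∈ J then insert v ((J.biUnion x).erase u) else (J.biUnion x).erase u := by
  ext e
  split_ifs with h
  · simp only [mem_biUnion, mem_insert, mem_erase, move]
    constructor
    · rintro ⟨i, hi, he⟩
      split_ifs at he with hij
      · rw [mem_insert, mem_erase] at he
        exact he.imp_right fun h => ⟨h.1, i, hi, h.2⟩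
      · rw [mem_erase] at he
        exact Or.inr ⟨he.1, i, hi, he.2⟩
    · rintro (rfl | ⟨he, i, hi, hx⟩)
      · exact ⟨j, h, by simp⟩
      · exact ⟨i, hi, by split_ifs <;> simp [he, hx]⟩
  · simp only [mem_biUnion, mem_erase, move]
    constructor
    · rintro ⟨i, hi, he⟩
      rw [if_neg (fun hij : i = j => h (hij ▸ hi)), mem_erase] at he
      exact ⟨he.1, i, hi, he.2⟩
    · rintro ⟨he, i, hi, hx⟩
      exact ⟨i, hi, by rw [if_neg (fun hij : i = j => h (hij ▸ hi)), mem_erase]; exact ⟨he, hx⟩⟩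

/-- `ℓ` disjoint parts whose union is a base. -/
structure IsConfig (M : Matroid E) (ℓ : ℕ) (x : ℕ → Finset E) : Prop where
  disjoint : (range ℓ : Set ℕ).PairwiseDisjoint x
  isBase : M.IsBase ((range ℓ).biUnion x : Finset E)

/-- `u` can be exchanged for `v`. The case `u = v` is included: then a move just puts `u` into
another part. -/
def Feasible (M : Matroid E) (ℓ : ℕ) (x : ℕ → Finset E) (u v : E) : Prop :=
  u ∈ (range ℓ).biUnion x ∧ v ∉ ((range ℓ).biUnion x).erase u ∧
    M.Indep (insert v (((range ℓ).biUnion x).erase u) : Finset E)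

theorem IsConfig.move {M : Matroid E} {ℓ : ℕ} {x : ℕ → Finset E} (hx : IsConfig M ℓ x) {u v : E}
    (h : Feasible M ℓ x u v) {j : ℕ} (hj : j < ℓ) : IsConfig M ℓ (move x u v j) := by
  obtain ⟨hu, hv, hi⟩ := h
  constructor
  · have hv' : ∀ i ∈ range ℓ, v ∉ (x i).erase u := fun i hi hvi =>
      hv (mem_erase.2 ⟨(mem_erase.1 hvi).1, mem_biUnion.2 ⟨i, hi, (mem_erase.1 hvi).2⟩⟩)
    have hd : ∀ a ∈ range ℓ, ∀ b ∈ range ℓ, a ≠ b → Disjoint ((x a).erase u) ((x b).erase u) :=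
      fun a ha b hb hab => (hx.disjoint ha hb hab).mono (erase_subset _ _) (erase_subset _ _)
    intro a ha b hb hab
    simp only [Function.onFun, OracleMax.move]
    have ha' : a ∈ range ℓ := ha
    have hb' : b ∈ range ℓ := hb
    split_ifs with h1 h2 h2
    · exact absurd (h1.trans h2.symm) hab
    · exact disjoint_insert_left.2 ⟨hv' b hb', hd a ha' b hb' hab⟩
    · exact disjoint_insert_right.2 ⟨hv' a ha', hd a ha' b hb' hab⟩
    · exact hd a ha' b hb' hab
  · rw [biUnion_move, if_pos (mem_range.2 hj)]
    by_cases hvS : v ∈ (range ℓ).biUnion x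
    · have : v = u := by
        by_contra hne
        exact hv (mem_erase.2 ⟨hne, hvS⟩)
      rw [this, insert_erase hu]
      exact hx.isBase
    · rw [coe_insert, coe_erase] at hi ⊢
      exact hx.isBase.exchange_isBase_of_indep (by simpa using hvS) hi

variable {g : Finset E → ℝ} {x : ℕ → Finset E} {ℓ : ℕ}

theorem sum_move_ge (hg : IsSubmodular g) (hm : Monotone g) (w : ℕ → ℝ) (hw : ∀ k, 0 ≤ w k)
    (u o : E) (j : ℕ) :
    ∑ J ∈ (range ℓ).powerset, (if j ∈ J then w #J *
        (g (insert o (J.biUnion x)) - g (J.biUnion x)) else 0) -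
      ∑ J ∈ (range ℓ).powerset, w #J * (g (J.biUnion x) - g ((J.biUnion x).erase u)) ≤
    ∑ J ∈ (range ℓ).powerset, w #J * (g (J.biUnion (move x u o j)) - g (J.biUnion x)) := by
  rw [← sum_sub_distrib]
  refine sum_le_sum fun J _ => ?_
  rw [biUnion_move]
  split_ifs with h
  · have := hg.insert_sub_le hm (erase_subset u (J.biUnion x)) o
    nlinarith [hw #J, mul_le_mul_of_nonneg_left this (hw #J)]
  · linarith

/-- Removing the elements of the parts one by one loses no more than removing whole parts. -/
theorem sum_erase_le_sum_parts (hg : IsSubmodular g) (hm : Monotone g)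
    (hx : (range ℓ : Set ℕ).PairwiseDisjoint x) {J : Finset ℕ} (hJ : J ⊆ range ℓ) :
    ∑ u ∈ (range ℓ).biUnion x, (g (J.biUnion x) - g ((J.biUnion x).erase u)) ≤
      ∑ i ∈ J, (g (J.biUnion x) - g ((J.erase i).biUnion x)) := by
  rw [sum_biUnion hx, ← sum_subset hJ]
  · refine sum_le_sum fun i hi => ?_
    refine (hg.sum_sub_erase_le hm _ _).trans (sub_le_sub_left (hm ?_) _)
    intro e he
    obtain ⟨k, hk, hek⟩ := mem_biUnion.1 he
    rw [mem_erase] at hk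
    exact mem_sdiff.2 ⟨mem_biUnion.2 ⟨k, hk.2, hek⟩,
      disjoint_left.1 (hx (hJ hk.2) (hJ hi) hk.1) hek⟩
  · intro i hi hiJ
    refine sum_eq_zero fun u hu => ?_
    rw [erase_eq_of_notMem, sub_self]
    intro h
    obtain ⟨k, hk, huk⟩ := mem_biUnion.1 h
    exact disjoint_left.1 (hx (hJ hk) hi (fun e => hiJ (e ▸ hk))) huk hu

/-- The total gain, for a monotone submodular function, of all moves that exchange `h o` for `o`. -/
theorem sum_sum_move_ge (hl : 0 < ℓ) (hg : IsSubmodular g) (hm : Monotone g)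
    (hx : (range ℓ : Set ℕ).PairwiseDisjoint x) (h0 : 0 ≤ g ∅) {O : Finset E} {h : E → E}
    (hinj : Set.InjOn h O) (hmem : ∀ o ∈ O, h o ∈ (range ℓ).biUnion x) :
    (topWeight ℓ - ℓ * linWeight ℓ) * g O - topWeight ℓ * g ((range ℓ).biUnion x) ≤
      ∑ o ∈ O, ∑ j ∈ range ℓ, ∑ J ∈ (range ℓ).powerset,
        (weight ℓ #J : ℝ) * (g (J.biUnion (move x (h o) o j)) - g (J.biUnion x)) := by
  have hw : ∀ k, (0 : ℝ) ≤ weight ℓ k := fun k => Nat.cast_nonneg _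
  refine le_trans ?_ (sum_le_sum fun o _ => sum_le_sum fun j _ =>
    sum_move_ge (x := x) (ℓ := ℓ) hg hm (fun k => (weight ℓ k : ℝ)) hw (h o) o j)
  simp only [sum_sub_distrib, sum_const, card_range, nsmul_eq_mul]
  have hgain : ∑ J ∈ (range ℓ).powerset, (weight ℓ #J * #J : ℝ) * (g O - g (J.biUnion x)) ≤
      ∑ o ∈ O, ∑ j ∈ range ℓ, ∑ J ∈ (range ℓ).powerset, (if j ∈ J then (weight ℓ #J : ℝ) *
        (g (insert o (J.biUnion x)) - g (J.biUnion x)) else 0) := by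
    have e1 : ∀ o ∈ O, ∑ j ∈ range ℓ, ∑ J ∈ (range ℓ).powerset,
        (if j ∈ J then (weight ℓ #J : ℝ) * (g (insert o (J.biUnion x)) - g (J.biUnion x)) else 0) =
        ∑ J ∈ (range ℓ).powerset, (weight ℓ #J * #J : ℝ) *
          (g (insert o (J.biUnion x)) - g (J.biUnion x)) := by
      intro o _
      rw [sum_comm]
      refine sum_congr rfl fun J hJ => ?_
      rw [sum_ite_mem, inter_eq_right.2 (mem_powerset.1 hJ), sum_const, nsmul_eq_mul]
      ring
    rw [sum_congr rfl e1, sum_comm]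
    refine sum_le_sum fun J _ => ?_
    rw [← mul_sum]
    refine mul_le_mul_of_nonneg_left ?_ (mul_nonneg (hw _) (Nat.cast_nonneg _))
    exact (sub_le_sub_right (hm subset_union_left) _).trans (hg.union_sub_le hm _ _)
  have hloss : ∑ o ∈ O, ∑ J ∈ (range ℓ).powerset,
      (weight ℓ #J : ℝ) * (g (J.biUnion x) - g ((J.biUnion x).erase (h o))) ≤
      ∑ J ∈ (range ℓ).powerset,
        (weight ℓ #J : ℝ) * ∑ i ∈ J, (g (J.biUnion x) - g ((J.erase i).biUnion x)) := by
    rw [sum_comm]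
    refine sum_le_sum fun J hJ => ?_
    rw [← mul_sum]
    refine mul_le_mul_of_nonneg_left ?_ (hw _)
    refine le_trans ?_ (sum_erase_le_sum_parts hg hm hx (mem_powerset.1 hJ))
    rw [← sum_image (f := fun u => g (J.biUnion x) - g ((J.biUnion x).erase u)) hinj]
    refine sum_le_sum_of_subset_of_nonneg ?_ fun u _ _ => sub_nonneg.2 (hm (erase_subset _ _))
    intro u hu
    obtain ⟨o, ho, rfl⟩ := mem_image.1 hu
    exact hmem o ho
  have htel := sum_weight_telescope hl (fun J => g (J.biUnion x))
  have hW := sum_weight_card hl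
  simp only [biUnion_empty] at htel
  have e2 : ∑ J ∈ (range ℓ).powerset, (weight ℓ #J * #J : ℝ) * (g O - g (J.biUnion x)) =
      (topWeight ℓ - ℓ * linWeight ℓ) * g O -
        ∑ J ∈ (range ℓ).powerset, (weight ℓ #J * #J : ℝ) * g (J.biUnion x) := by
    simp_rw [mul_sub]
    rw [sum_sub_distrib, ← sum_mul, hW]
  have h3 := mul_le_mul_of_nonneg_left hloss (Nat.cast_nonneg (α := ℝ) ℓ)
  have h4 : (0 : ℝ) ≤ ℓ * linWeight ℓ * g ∅ := by positivity
  rw [← mul_sum]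
  linarith

theorem sum_biUnion_move {M : Matroid E} {u v : E} (h : Feasible M ℓ x u v) {j : ℕ} (hj : j < ℓ)
    (a : E → ℝ) : ∑ e ∈ (range ℓ).biUnion (move x u v j), a e =
      ∑ e ∈ (range ℓ).biUnion x, a e + (a v - a u) := by
  rw [biUnion_move, if_pos (mem_range.2 hj), sum_insert h.2.1, sum_erase_eq_sub h.1]
  ring

variable [Fintype E] {f : Finset E → ℝ}

/-- The potential that the local search increases. -/
def potential (f : Finset E → ℝ) (ℓ : ℕ) (x : ℕ → Finset E) : ℝ :=
  ∑ J ∈ (range ℓ).powerset, (weight ℓ #J : ℝ) * f (J.biUnion x) +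
    linWeight ℓ * ∑ e ∈ (range ℓ).biUnion x, lin f e

/-- The change of the potential in a move, in the form in which it is computed. -/
def gain (f : Finset E → ℝ) (ℓ : ℕ) (x : ℕ → Finset E) (u v : E) (j : ℕ) : ℝ :=
  ∑ J ∈ (range ℓ).powerset, (weight ℓ #J : ℝ) * (f (J.biUnion (move x u v j)) - f (J.biUnion x)) +
    linWeight ℓ * (lin f v - lin f u)

theorem potential_move {M : Matroid E} {u v : E} (h : Feasible M ℓ x u v) {j : ℕ} (hj : j < ℓ) :
    potential f ℓ (move x u v j) = potential f ℓ x + gain f ℓ x u v j := by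
  simp only [potential, gain, sum_biUnion_move h hj, mul_sub, sum_sub_distrib]
  ring

/-- In terms of the nonlinear part the coefficient of the linear part of the potential is larger,
by the symmetric share of every part. -/
theorem mul_potential (hl : 0 < ℓ) (hx : (range ℓ : Set ℕ).PairwiseDisjoint x) :
    ℓ * potential f ℓ x =
      ℓ * ∑ J ∈ (range ℓ).powerset, (weight ℓ #J : ℝ) * nonlin f (J.biUnion x) +
        topWeight ℓ * ∑ e ∈ (range ℓ).biUnion x, lin f e := by
  have h := sum_weight_sum hl (fun i => ∑ e ∈ x i, lin f e)
  have e1 : ∀ J ∈ (range ℓ).powerset, (weight ℓ #J : ℝ) * f (J.biUnion x) =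
      (weight ℓ #J : ℝ) * nonlin f (J.biUnion x) +
        (weight ℓ #J : ℝ) * ∑ i ∈ J, ∑ e ∈ x i, lin f e := by
    intro J hJ
    rw [← sum_biUnion (hx.subset (by exact_mod_cast mem_powerset.1 hJ)), nonlin]
    ring
  rw [potential, sum_congr rfl e1, sum_add_distrib, sum_biUnion hx]
  linear_combination h

theorem mul_gain {M : Matroid E} (hl : 0 < ℓ) (hx : IsConfig M ℓ x) {u v : E}
    (h : Feasible M ℓ x u v) {j : ℕ} (hj : j < ℓ) :
    ℓ * gain f ℓ x u v j = ℓ * ∑ J ∈ (range ℓ).powerset, (weight ℓ #J : ℝ) *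
        (nonlin f (J.biUnion (move x u v j)) - nonlin f (J.biUnion x)) +
      topWeight ℓ * (lin f v - lin f u) := by
  have h1 := mul_potential (f := f) hl (hx.move h hj).disjoint
  have h2 := mul_potential (f := f) hl hx.disjoint
  rw [potential_move h hj, sum_biUnion_move h hj] at h1
  simp only [mul_sub, sum_sub_distrib] at h1 h2 ⊢
  linarith

/-- The guarantee for a configuration in which no move gains more than `δ`. -/
theorem local_optimum {M : Matroid E} (hE : M.E = Set.univ) (hl : 0 < ℓ) (hf : IsSubmodular f)
    (hm : Monotone f) (h0 : ∀ S, 0 ≤ f S) (hx : IsConfig M ℓ x) {δ : ℝ} (hδ0 : 0 ≤ δ)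
    (hδ : ∀ u v, ∀ j < ℓ, Feasible M ℓ x u v → gain f ℓ x u v j ≤ δ)
    {O : Finset E} (hO : M.Indep (O : Set E)) :
    (topWeight ℓ - ℓ * linWeight ℓ) * f O + ℓ * linWeight ℓ * ∑ e ∈ O, lin f e ≤
      topWeight ℓ * f ((range ℓ).biUnion x) + Fintype.card E * ℓ * δ := by
  obtain ⟨h, hinj, hh⟩ := exists_exchange_injection hE hx.isBase hO
  have hl' : (0 : ℝ) < ℓ := by exact_mod_cast hl
  have h1 := sum_sum_move_ge hl (isSubmodular_nonlin hf) (monotone_nonlin hf hm) hx.disjoint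
    (by simpa [nonlin] using h0 ∅) hinj (fun o ho => (hh o ho).1)
  have h2 : ∑ o ∈ O, ∑ j ∈ range ℓ, ℓ * gain f ℓ x (h o) o j ≤
      Fintype.card E * ℓ * (ℓ * δ) := by
    calc _ ≤ ∑ o ∈ O, ∑ j ∈ range ℓ, ℓ * δ :=
          sum_le_sum fun o ho => sum_le_sum fun j hj =>
            mul_le_mul_of_nonneg_left (hδ _ _ j (mem_range.1 hj) (hh o ho)) hl'.le
      _ = #O * (ℓ * (ℓ * δ)) := by simp
      _ ≤ Fintype.card E * (ℓ * (ℓ * δ)) := by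
          refine mul_le_mul_of_nonneg_right ?_ (by positivity)
          exact_mod_cast card_le_univ O
      _ = _ := by ring
  have h3 : ∑ o ∈ O, ∑ j ∈ range ℓ, ℓ * gain f ℓ x (h o) o j =
      ℓ * (∑ o ∈ O, ∑ j ∈ range ℓ, ∑ J ∈ (range ℓ).powerset, (weight ℓ #J : ℝ) *
        (nonlin f (J.biUnion (move x (h o) o j)) - nonlin f (J.biUnion x))) +
      ℓ * (topWeight ℓ * (∑ o ∈ O, lin f o - ∑ o ∈ O, lin f (h o))) := by
    rw [sum_congr rfl fun o ho => sum_congr rfl fun j hj =>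
      mul_gain hl hx (hh o ho) (mem_range.1 hj)]
    simp only [sum_add_distrib, ← mul_sum, sum_const, card_range, nsmul_eq_mul, sum_sub_distrib]
    ring
  have h4 : ∑ o ∈ O, lin f (h o) ≤ ∑ e ∈ (range ℓ).biUnion x, lin f e := by
    rw [← sum_image (f := lin f) hinj]
    refine sum_le_sum_of_subset_of_nonneg ?_ fun u _ _ => lin_nonneg hm u
    intro u hu
    obtain ⟨o, ho, rfl⟩ := mem_image.1 hu
    exact (hh o ho).1
  rw [h3] at h2
  have h5 : (topWeight ℓ - ℓ * linWeight ℓ) * nonlin f O -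
      topWeight ℓ * nonlin f ((range ℓ).biUnion x) +
      topWeight ℓ * (∑ o ∈ O, lin f o - ∑ o ∈ O, lin f (h o)) ≤ Fintype.card E * ℓ * δ := by
    refine le_of_mul_le_mul_left ?_ hl'
    have := mul_le_mul_of_nonneg_left h1 hl'.le
    linarith
  have h6 := mul_le_mul_of_nonneg_left h4 (Nat.cast_nonneg (α := ℝ) (topWeight ℓ))
  simp only [nonlin] at h5
  linarith

end LocalSearch

/-! ### The program

Memory layout. Set cells: `0` the current base, `1` the ground set, `2` scratch, `3` always empty,
`4 + i` the part with index `i`. Real cells: `0` the largest value of an independent singleton, `1`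
scratch, `2` the gain of a move, `3` a multiple of it, `4` always zero. Natural number cells: `0`
the size `n`, `1` the constant one, `2` and `3` the elements of the move that is tried, and `4`,
`5`, `6` further loop counters. -/

namespace Code

/-- Set cell `2` becomes the union of the parts with index in `J`. -/
noncomputable def unionCode (J : Finset ℕ) : Code :=
  seq (instr (.setUnion (.dir 2) (.dir 3) (.dir 3)))
    (block (J.toList.map fun i => instr (.setUnion (.dir 2) (.dir 2) (.dir (4 + i)))))

/-- Add to real cell `2` the contribution of the set of parts `J` to the gain of a move. -/
noncomputable def subsetCode (ℓ j : ℕ) (J : Finset ℕ) : Code :=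
  block [unionCode J, instr (.value (.dir 1) (.dir 2)),
    rep (weight ℓ #J) (instr (.realSub (.dir 2) (.dir 2) (.dir 1))),
    instr (.setErase (.dir 2) (.dir 2)),
    if j ∈ J then instr (.setInsert (.dir 2) (.dir 3)) else skip,
    instr (.value (.dir 1) (.dir 2)),
    rep (weight ℓ #J) (instr (.realAdd (.dir 2) (.dir 2) (.dir 1)))]

/-- Real cell `2` becomes the gain of the move that exchanges the element in natural number cell
`2` for the element in natural number cell `3`, which is put into part `j`. -/
noncomputable def gainCode (ℓ j : ℕ) : Code :=
  block [instr (.realSub (.dir 2) (.dir 2) (.dir 2)),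
    block ((range ℓ).powerset.toList.map (subsetCode ℓ j)),
    instr (.setUnion (.dir 2) (.dir 1) (.dir 3)),
    instr (.setErase (.dir 2) (.dir 2)),
    instr (.value (.dir 1) (.dir 2)),
    rep (linWeight ℓ) (instr (.realAdd (.dir 2) (.dir 2) (.dir 1))),
    instr (.setUnion (.dir 2) (.dir 1) (.dir 3)),
    instr (.setErase (.dir 2) (.dir 3)),
    instr (.value (.dir 1) (.dir 2)),
    rep (linWeight ℓ) (instr (.realSub (.dir 2) (.dir 2) (.dir 1)))]

/-- Real cell `3` becomes `n * C` times real cell `2`. -/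
def scaleCode (C : ℕ) : Code :=
  seq (instr (.realSub (.dir 3) (.dir 3) (.dir 3)))
    (forN 4 (rep C (instr (.realAdd (.dir 3) (.dir 3) (.dir 2)))))

/-- Carry out a move. -/
noncomputable def moveCode (ℓ j : ℕ) : Code :=
  block [instr (.setErase (.dir 0) (.dir 2)), instr (.setInsert (.dir 0) (.dir 3)),
    block ((range ℓ).toList.map fun i => instr (.setErase (.dir (4 + i)) (.dir 2))),
    instr (.setInsert (.dir (4 + j)) (.dir 3))]

/-- Carry out a move if it is feasible and its gain is large enough. -/
noncomputable def tryCode (ℓ C j : ℕ) : Code :=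
  ite (.mem (.dir 2) (.dir 0))
    (block [instr (.setUnion (.dir 2) (.dir 0) (.dir 3)), instr (.setErase (.dir 2) (.dir 2)),
      ite (.mem (.dir 3) (.dir 2)) skip
        (seq (instr (.setInsert (.dir 2) (.dir 3)))
          (ite (.indep (.dir 2))
            (block [gainCode ℓ j, scaleCode C, ite (.realLt (.dir 0) (.dir 3)) (moveCode ℓ j) skip])
            skip))])
    skip

/-- Try all moves. -/
noncomputable def roundCode (ℓ C : ℕ) : Code :=
  forN 2 (forN 3 (block ((range ℓ).toList.map (tryCode ℓ C))))

/-- Greedily build a base, all of which is put into part `0`, and determine the largest value of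
an independent singleton. -/
def initCode : Code :=
  forN 2 (block [instr (.setInsert (.dir 1) (.dir 2)),
    instr (.setUnion (.dir 2) (.dir 3) (.dir 3)), instr (.setInsert (.dir 2) (.dir 2)),
    ite (.indep (.dir 2)) (seq (instr (.value (.dir 1) (.dir 2)))
      (ite (.realLt (.dir 0) (.dir 1)) (instr (.realAdd (.dir 0) (.dir 1) (.dir 4))) skip)) skip,
    instr (.setUnion (.dir 2) (.dir 0) (.dir 3)), instr (.setInsert (.dir 2) (.dir 2)),
    ite (.indep (.dir 2)) (seq (instr (.setInsert (.dir 0) (.dir 2)))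
      (instr (.setInsert (.dir 4) (.dir 2)))) skip])

/-- The whole algorithm. -/
noncomputable def mainCode (ℓ C D : ℕ) : Code :=
  seq initCode (rep D (forN 5 (forN 6 (roundCode ℓ C))))

theorem keeps_gainCode {ℓ j k : ℕ} : (gainCode ℓ j).Keeps k := by
  have h1 : ∀ J, (subsetCode ℓ j J).Keeps k := by
    intro J
    refine keeps_block.2 ?_
    simp only [List.mem_cons, List.not_mem_nil, or_false, forall_eq_or_imp, forall_eq]
    refine ⟨⟨trivial, keeps_block.2 ?_⟩, trivial, keeps_rep trivial, trivial, ?_, trivial,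
      keeps_rep trivial⟩
    · intro c hc
      obtain ⟨i, _, rfl⟩ := List.mem_map.1 hc
      trivial
    · split_ifs <;> trivial
  refine keeps_block.2 ?_
  simp only [List.mem_cons, List.not_mem_nil, or_false, forall_eq_or_imp, forall_eq]
  refine ⟨trivial, keeps_block.2 ?_, trivial, trivial, trivial, keeps_rep trivial, trivial,
    trivial, trivial, keeps_rep trivial⟩
  intro c hc
  obtain ⟨J, _, rfl⟩ := List.mem_map.1 hc
  exact h1 J

theorem wellFormed_gainCode {ℓ j : ℕ} : (gainCode ℓ j).WellFormed := by
  have h1 : ∀ J, (subsetCode ℓ j J).WellFormed := by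
    intro J
    refine wellFormed_block.2 ?_
    simp only [List.mem_cons, List.not_mem_nil, or_false, forall_eq_or_imp, forall_eq]
    refine ⟨⟨trivial, wellFormed_block.2 ?_⟩, trivial, wellFormed_rep trivial, trivial, ?_, trivial,
      wellFormed_rep trivial⟩
    · intro c hc
      obtain ⟨i, _, rfl⟩ := List.mem_map.1 hc
      trivial
    · split_ifs <;> trivial
  refine wellFormed_block.2 ?_
  simp only [List.mem_cons, List.not_mem_nil, or_false, forall_eq_or_imp, forall_eq]
  refine ⟨trivial, wellFormed_block.2 ?_, trivial, trivial, trivial, wellFormed_rep trivial, trivial,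
    trivial, trivial, wellFormed_rep trivial⟩
  intro c hc
  obtain ⟨J, _, rfl⟩ := List.mem_map.1 hc
  exact h1 J

theorem keeps_tryCode {ℓ C j k : ℕ} (h1 : k ≠ 1) (h4 : k ≠ 4) : (tryCode ℓ C j).Keeps k := by
  refine ⟨⟨trivial, trivial, ⟨trivial, trivial, ⟨keeps_gainCode,
    ⟨trivial, h4, h1, keeps_rep trivial⟩, ⟨⟨trivial, trivial, keeps_block.2 ?_, trivial, trivial⟩,
      trivial⟩, trivial⟩, trivial⟩, trivial⟩, trivial⟩
  intro c hc
  obtain ⟨i, _, rfl⟩ := List.mem_map.1 hc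
  trivial

theorem wellFormed_tryCode {ℓ C j : ℕ} : (tryCode ℓ C j).WellFormed := by
  refine ⟨⟨trivial, trivial, ⟨trivial, trivial, ⟨wellFormed_gainCode,
    ⟨trivial, by decide, by decide, keeps_rep trivial, wellFormed_rep trivial⟩,
    ⟨⟨trivial, trivial, wellFormed_block.2 ?_, trivial, trivial⟩,
      trivial⟩, trivial⟩, trivial⟩, trivial⟩, trivial⟩
  intro c hc
  obtain ⟨i, _, rfl⟩ := List.mem_map.1 hc
  trivial

theorem keeps_try_block {ℓ C k : ℕ} (h1 : k ≠ 1) (h4 : k ≠ 4) :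
    (block ((range ℓ).toList.map (tryCode ℓ C))).Keeps k := by
  refine keeps_block.2 fun c hc => ?_
  obtain ⟨i, _, rfl⟩ := List.mem_map.1 hc
  exact keeps_tryCode h1 h4

theorem keeps_roundCode {ℓ C k : ℕ} (h1 : k ≠ 1) (h2 : k ≠ 2) (h3 : k ≠ 3) (h4 : k ≠ 4) :
    (roundCode ℓ C).Keeps k :=
  ⟨h2, h1, h3, h1, keeps_try_block h1 h4⟩

theorem wellFormed_mainCode {ℓ C D : ℕ} : (mainCode ℓ C D).WellFormed := by
  refine ⟨?_, wellFormed_rep ⟨by decide, by decide, ⟨by decide, by decide,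
    keeps_roundCode (by decide) (by decide) (by decide) (by decide)⟩, by decide, by decide,
    keeps_roundCode (by decide) (by decide) (by decide) (by decide), by decide, by decide,
    ⟨by decide, by decide, keeps_try_block (by decide) (by decide)⟩, by decide, by decide,
    keeps_try_block (by decide) (by decide), wellFormed_block.2 fun c hc => ?_⟩⟩
  · simp [initCode, WellFormed, Keeps, block]
  · obtain ⟨i, _, rfl⟩ := List.mem_map.1 hc
    exact wellFormed_tryCode

/-! ### Correctness of the program -/

variable {n : ℕ} {f : Finset (Fin n) → ℝ} {M : Matroid (Fin n)}

theorem elems_val (u : Fin n) : elems n u = {u} := by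
  ext e; simp [elems, Fin.ext_iff]

theorem run_rep_realAdd {a b : ℕ} (hab : b ≠ a) (k : ℕ) (s : State n) :
    run f M (rep k (instr (.realAdd (.dir a) (.dir a) (.dir b)))) s =
      s.putReal (.dir a) (s.real a + k * s.real b) := by
  induction k generalizing s with
  | zero => simp [State.putReal, Addr.eval]
  | succ k ih =>
    rw [run_rep_succ, ih]
    simp [run, Instr.apply, State.putReal, State.getReal, Addr.eval, hab]
    congr 1; ring

theorem run_rep_realSub {a b : ℕ} (hab : b ≠ a) (k : ℕ) (s : State n) :
    run f M (rep k (instr (.realSub (.dir a) (.dir a) (.dir b)))) s =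
      s.putReal (.dir a) (s.real a - k * s.real b) := by
  induction k generalizing s with
  | zero => simp [State.putReal, Addr.eval]
  | succ k ih =>
    rw [run_rep_succ, ih]
    simp [run, Instr.apply, State.putReal, State.getReal, Addr.eval, hab]
    congr 1; ring

theorem run_unionCode (J : Finset ℕ) (s : State n) (h3 : s.set 3 = ∅) :
    run f M (unionCode J) s = s.putSet (.dir 2) (J.biUnion fun i => s.set (4 + i)) := by
  refine block_induction J _ (fun B s' => s' = s.putSet (.dir 2) (B.biUnion fun i => s.set (4 + i)))
    ?_ ?_
  · simp [run, Instr.apply, State.putSet, State.getSet, Addr.eval, h3]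
  · rintro B i _ _ s' rfl
    have : 4 + i ≠ 2 := by omega
    simp [run, Instr.apply, State.putSet, State.getSet, Addr.eval, this, union_comm]

/-- The natural numbers, the real cell `0`, and all sets but that in the scratch cell `2` agree. -/
structure Agree (s s' : State n) : Prop where
  nat : s'.nat = s.nat
  set : ∀ k ≠ 2, s'.set k = s.set k
  best : s'.real 0 = s.real 0

/-- The parts `x` are stored in the cells `4, 5, …`, their union in cell `0`; cell `1` holds the
ground set, cell `3` the empty set, and the real cell `0` the number `W`. -/
structure Rep (W : ℝ) (ℓ : ℕ) (x : ℕ → Finset (Fin n)) (s : State n) : Prop where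
  sol : s.set 0 = (range ℓ).biUnion x
  ground : s.set 1 = univ
  empty : s.set 3 = ∅
  parts : ∀ i < ℓ, s.set (4 + i) = x i
  best : s.real 0 = W

theorem Rep.of_eq {W : ℝ} {ℓ : ℕ} {x : ℕ → Finset (Fin n)} {s s' : State n} (h : Rep W ℓ x s)
    (h1 : ∀ k ≠ 2, s'.set k = s.set k) (h2 : s'.real 0 = s.real 0) : Rep W ℓ x s' where
  sol := by rw [h1 0 (by decide), h.sol]
  ground := by rw [h1 1 (by decide), h.ground]
  empty := by rw [h1 3 (by decide), h.empty]
  parts i hi := by rw [h1 _ (by omega), h.parts i hi]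
  best := by rw [h2, h.best]

theorem run_subsetCode {W : ℝ} {ℓ : ℕ} {x : ℕ → Finset (Fin n)} {s : State n} (h : Rep W ℓ x s)
    {u v : Fin n} (hu : s.nat 2 = u) (hv : s.nat 3 = v) (j : ℕ) {J : Finset ℕ}
    (hJ : J ⊆ range ℓ) :
    Agree s (run f M (subsetCode ℓ j J) s) ∧ (run f M (subsetCode ℓ j J) s).real 2 =
      s.real 2 + weight ℓ #J * (f (J.biUnion (move x u v j)) - f (J.biUnion x)) := by
  have hx : (J.biUnion fun i => s.set (4 + i)) = J.biUnion x :=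
    biUnion_congr rfl fun i hi => h.parts i (mem_range.1 (hJ hi))
  rw [biUnion_move]
  simp only [subsetCode, run_block_cons, run_block_nil, run_unionCode J s h.empty, hx]
  split_ifs with hj <;>
  · simp only [run, run_rep_realAdd (show 1 ≠ 2 by decide), run_rep_realSub (show 1 ≠ 2 by decide)]
    refine ⟨⟨rfl, fun k hk => ?_, ?_⟩, ?_⟩
    · simp [Instr.apply, State.putSet, State.putReal, Addr.eval, hk]
    · simp [Instr.apply, State.putSet, State.putReal, Addr.eval]
    · simp [Instr.apply, State.putSet, State.putReal, State.getSet, State.getNat, Addr.eval,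
        hu, hv, elems_val, sdiff_singleton_eq_erase, union_comm _ {v}]
      try ring

theorem run_gainCode {W : ℝ} {ℓ : ℕ} {x : ℕ → Finset (Fin n)} {s : State n} (h : Rep W ℓ x s)
    {u v : Fin n} (hu : s.nat 2 = u) (hv : s.nat 3 = v) (j : ℕ) :
    Agree s (run f M (gainCode ℓ j) s) ∧
      (run f M (gainCode ℓ j) s).real 2 = gain f ℓ x u v j := by
  simp only [gainCode, run_block_cons, run_block_nil]
  set s₁ := run f M (instr (.realSub (.dir 2) (.dir 2) (.dir 2))) s with hs₁
  have h1 : Agree s s₁ ∧ s₁.real 2 = 0 := by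
    refine ⟨⟨rfl, fun _ _ => rfl, ?_⟩, ?_⟩ <;>
      simp [hs₁, run, Instr.apply, State.putReal, State.getReal, Addr.eval]
  obtain ⟨ha, hg⟩ := block_induction (f := f) (M := M) (range ℓ).powerset (subsetCode ℓ j)
    (fun B s' => Agree s s' ∧ s'.real 2 = ∑ J ∈ B, (weight ℓ #J : ℝ) *
      (f (J.biUnion (move x u v j)) - f (J.biUnion x))) (s := s₁) (by simpa using h1) (by
      rintro B J hJ hJB s' ⟨ha, hg⟩
      obtain ⟨hb, hr⟩ := run_subsetCode (f := f) (M := M) (h.of_eq ha.set ha.best)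
        (by rw [ha.nat, hu]) (by rw [ha.nat, hv]) j (mem_powerset.1 hJ)
      refine ⟨⟨hb.nat.trans ha.nat, fun k hk => (hb.set k hk).trans (ha.set k hk),
        hb.best.trans ha.best⟩, ?_⟩
      rw [hr, hg, sum_insert hJB, add_comm])
  generalize run f M (block ((range ℓ).powerset.toList.map (subsetCode ℓ j))) s₁ = s₂ at ha hg
  have e1 := ha.set 1 (by decide)
  have e3 := ha.set 3 (by decide)
  rw [h.ground] at e1
  rw [h.empty] at e3
  have hu' : s₂.nat 2 = u := by rw [ha.nat, hu]
  have hv' : s₂.nat 3 = v := by rw [ha.nat, hv]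
  simp only [run, run_rep_realAdd (show 1 ≠ 2 by decide), run_rep_realSub (show 1 ≠ 2 by decide)]
  refine ⟨⟨ha.nat, fun k hk => ?_, ?_⟩, ?_⟩
  · simp [Instr.apply, State.putSet, State.putReal, Addr.eval, hk, ha.set k hk]
  · simp [Instr.apply, State.putSet, State.putReal, Addr.eval, ha.best]
  · simp [Instr.apply, State.putSet, State.putReal, State.getSet, State.getNat, Addr.eval,
      hu', hv', elems_val, sdiff_singleton_eq_erase, e1, e3, hg, gain, lin]
    ring

theorem run_scaleCode (C : ℕ) (s : State n) :
    (run f M (scaleCode C) s).set = s.set ∧ (run f M (scaleCode C) s).real 0 = s.real 0 ∧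
      (run f M (scaleCode C) s).real 3 = n * (C * s.real 2) ∧
      ∀ k, k ≠ 1 → k ≠ 4 → (run f M (scaleCode C) s).nat k = s.nat k := by
  have h := forN_induction (f := f) (M := M) (i := 4)
    (c := rep C (instr (.realAdd (.dir 3) (.dir 3) (.dir 2)))) (by decide) (keeps_rep trivial)
    (fun m s' => s'.set = s.set ∧ s'.real 0 = s.real 0 ∧ s'.real 2 = s.real 2 ∧
      s'.real 3 = m * (C * s.real 2)) (s := run f M (instr (.realSub (.dir 3) (.dir 3) (.dir 3))) s)
    (by simp [run, Instr.apply, State.putReal, State.getReal, Addr.eval, reset, State.putNat])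
    (by
      rintro m _ s' _ ⟨h1, h2, h3, h4⟩
      rw [run_rep_realAdd (show 2 ≠ 3 by decide)]
      refine ⟨h1, ?_, ?_, ?_⟩ <;>
        simp [incr, State.putReal, State.putNat, Addr.eval, h2, h3, h4]
      ring)
  refine ⟨h.1, h.2.1, h.2.2.2, fun k h1 h4 => run_nat (scaleCode C) ⟨trivial, h4, h1, keeps_rep trivial⟩ s⟩

theorem run_moveCode {W : ℝ} {ℓ : ℕ} {x : ℕ → Finset (Fin n)} {s : State n} (h : Rep W ℓ x s)
    {u v : Fin n} (hu : s.nat 2 = u) (hv : s.nat 3 = v) {j : ℕ} (hj : j < ℓ) :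
    Rep W ℓ (move x u v j) (run f M (moveCode ℓ j) s) := by
  simp only [moveCode, run_block_cons, run_block_nil]
  set s₁ := run f M (instr (.setInsert (.dir 0) (.dir 3)))
    (run f M (instr (.setErase (.dir 0) (.dir 2))) s) with hs₁
  have h0 : s₁.nat = s.nat ∧ s₁.real = s.real ∧ s₁.set 0 = insert v ((s.set 0).erase u) ∧
      ∀ k ≠ 0, s₁.set k = s.set k := by
    refine ⟨rfl, rfl, ?_, fun k hk => ?_⟩
    · simp [hs₁, run, Instr.apply, State.putSet, State.getSet, State.getNat, Addr.eval,
        hu, hv, elems_val, sdiff_singleton_eq_erase, union_comm _ {v}]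
    · simp [hs₁, run, Instr.apply, State.putSet, Addr.eval, hk]
  have h1 := block_induction (f := f) (M := M) (range ℓ)
    (fun i => instr (.setErase (.dir (4 + i)) (.dir 2)))
    (fun B s' => s'.nat = s.nat ∧ s'.real = s.real ∧ s'.set 0 = insert v ((s.set 0).erase u) ∧
      (∀ k < 4, k ≠ 0 → s'.set k = s.set k) ∧
      ∀ i, s'.set (4 + i) = if i ∈ B then (s.set (4 + i)).erase u else s.set (4 + i)) (s := s₁)
    ⟨h0.1, h0.2.1, h0.2.2.1, fun k _ hk => h0.2.2.2 k hk, fun i => by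
      simpa using h0.2.2.2 (4 + i) (by omega)⟩ (by
      rintro B i _ hiB s' ⟨a1, a2, a3, a4, a5⟩
      refine ⟨a1, a2, ?_, fun k hk hk0 => ?_, fun m => ?_⟩
      · have : 0 ≠ 4 + i := by omega
        simp [run, Instr.apply, State.putSet, Addr.eval, this, a3]
      · have : k ≠ 4 + i := by omega
        simp [run, Instr.apply, State.putSet, Addr.eval, this, a4 k hk hk0]
      · have hu' : s'.nat 2 = u := by rw [a1, hu]
        by_cases hm : m = i
        · subst hm
          simp [run, Instr.apply, State.putSet, State.getSet, State.getNat, Addr.eval, hu',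
            elems_val, sdiff_singleton_eq_erase, a5, hiB]
        · simp [run, Instr.apply, State.putSet, Addr.eval, hm, a5])
  generalize run f M (block ((range ℓ).toList.map
    fun i => instr (.setErase (.dir (4 + i)) (.dir 2)))) s₁ = s₂ at h1
  obtain ⟨a1, a2, a3, a4, a5⟩ := h1
  have hv' : s₂.nat 3 = v := by rw [a1, hv]
  have hk : ∀ k < 4, (run f M (instr (.setInsert (.dir (4 + j)) (.dir 3))) s₂).set k = s₂.set k := by
    intro k hk
    have : k ≠ 4 + j := by omega
    simp [run, Instr.apply, State.putSet, Addr.eval, this]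
  constructor
  · rw [hk 0 (by decide), a3, h.sol, biUnion_move, if_pos (mem_range.2 hj)]
  · rw [hk 1 (by decide), a4 1 (by decide) (by decide), h.ground]
  · rw [hk 3 (by decide), a4 3 (by decide) (by decide), h.empty]
  · intro i hi
    by_cases hij : i = j
    · subst hij
      simp [run, Instr.apply, State.putSet, State.getSet, State.getNat, Addr.eval, hv', elems_val,
        a5, hi, h.parts, move, union_comm _ {v}]
    · simp [run, Instr.apply, State.putSet, Addr.eval, hij, a5, hi, h.parts, move]
  · simp [run, Instr.apply, State.putSet, a2, h.best]

theorem mem_holds {s : State n} {i a : ℕ} {u : Fin n} (hu : s.nat i = u) :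
    Test.Holds M s (.mem (.dir i) (.dir a)) ↔ u ∈ s.set a := by
  simp only [Test.Holds, State.getSet, State.getNat, Addr.eval, hu, ← Fin.ext_iff]
  simp

/-- The moves that the algorithm carries out. -/
def Improving (f : Finset (Fin n) → ℝ) (M : Matroid (Fin n)) (W : ℝ) (ℓ C : ℕ)
    (x : ℕ → Finset (Fin n)) (u v : Fin n) (j : ℕ) : Prop :=
  Feasible M ℓ x u v ∧ W < n * (C * gain f ℓ x u v j)

open Classical in
theorem run_tryCode {W : ℝ} {ℓ : ℕ} {x : ℕ → Finset (Fin n)} {s : State n} (h : Rep W ℓ x s)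
    {u v : Fin n} (hu : s.nat 2 = u) (hv : s.nat 3 = v) {j : ℕ} (hj : j < ℓ) (C : ℕ) :
    Rep W ℓ (if Improving f M W ℓ C x u v j then move x u v j else x)
      (run f M (tryCode ℓ C j) s) := by
  rw [tryCode]
  by_cases huS : u ∈ (range ℓ).biUnion x
  swap
  · rw [run_ite_neg (by rwa [mem_holds hu, h.sol]), if_neg fun hi => huS hi.1.1]
    exact h
  rw [run_ite_pos (by rwa [mem_holds hu, h.sol])]
  simp only [run_block_cons, run_block_nil, run_instr]
  set s₁ := Instr.apply f (Instr.apply f s (.setUnion (.dir 2) (.dir 0) (.dir 3)))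
    (.setErase (.dir 2) (.dir 2)) with hs₁
  have h1 : Rep W ℓ x s₁ := h.of_eq
    (fun k hk => by simp [hs₁, Instr.apply, State.putSet, Addr.eval, hk]) rfl
  have e1 : s₁.set 2 = ((range ℓ).biUnion x).erase u := by
    simp [hs₁, Instr.apply, State.putSet, State.getSet, State.getNat, Addr.eval, hu, elems_val,
      sdiff_singleton_eq_erase, h.sol, h.empty]
  have hv1 : s₁.nat 3 = v := hv
  by_cases hvS : v ∈ ((range ℓ).biUnion x).erase u
  · rw [run_ite_pos (by rwa [mem_holds hv1, e1]), if_neg fun hi => hi.1.2.1 hvS]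
    exact h1
  rw [run_ite_neg (by rwa [mem_holds hv1, e1]), run_seq, run_instr]
  set s₂ := Instr.apply f s₁ (.setInsert (.dir 2) (.dir 3)) with hs₂
  have h2 : Rep W ℓ x s₂ := h1.of_eq
    (fun k hk => by simp [hs₂, Instr.apply, State.putSet, Addr.eval, hk]) rfl
  have e2 : Test.Holds M s₂ (.indep (.dir 2)) ↔
      M.Indep (insert v (((range ℓ).biUnion x).erase u) : Finset (Fin n)) := by
    simp only [Test.Holds, hs₂, Instr.apply, State.putSet, State.getSet, State.getNat, Addr.eval,
      hv1, elems_val, e1, Function.update_self, union_comm _ {v}, ← insert_eq]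
  by_cases hI : M.Indep (insert v (((range ℓ).biUnion x).erase u) : Finset (Fin n))
  swap
  · rw [run_ite_neg (by rwa [e2]), if_neg fun hi => hI hi.1.2.2]
    exact h2
  rw [run_ite_pos (by rwa [e2])]
  simp only [run_block_cons, run_block_nil]
  obtain ⟨ha, hg⟩ := run_gainCode (f := f) (M := M) h2 (u := u) (v := v) hu hv j
  obtain ⟨b1, b2, b3, b4⟩ := run_scaleCode (f := f) (M := M) C (run f M (gainCode ℓ j) s₂)
  generalize run f M (scaleCode C) (run f M (gainCode ℓ j) s₂) = s₃ at b1 b2 b3 b4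
  have h3 : Rep W ℓ x s₃ := h2.of_eq (fun k hk => by rw [b1, ha.set k hk]) (by rw [b2, ha.best])
  have e3 : Test.Holds M s₃ (.realLt (.dir 0) (.dir 3)) ↔ Improving f M W ℓ C x u v j := by
    simp only [Test.Holds, State.getReal, Addr.eval, h3.best, b3, hg, Improving]
    exact ⟨fun hw => ⟨⟨huS, hvS, hI⟩, hw⟩, And.right⟩
  by_cases hi : Improving f M W ℓ C x u v j
  · rw [run_ite_pos (e3.2 hi), if_pos hi]
    exact run_moveCode h3 (by rw [b4 2 (by decide) (by decide), ha.nat]; exact hu)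
      (by rw [b4 3 (by decide) (by decide), ha.nat]; exact hv) hj
  · rw [run_ite_neg (e3.not.2 hi), if_neg hi]
    exact h3

/-- No move is improving. -/
def LocalOpt (f : Finset (Fin n) → ℝ) (M : Matroid (Fin n)) (W : ℝ) (ℓ C : ℕ)
    (x : ℕ → Finset (Fin n)) : Prop :=
  ∀ u v : Fin n, ∀ j < ℓ, ¬ Improving f M W ℓ C x u v j

/-- The state of a round that started with the parts `x₀` in which the moves in `A` have been
tried: either some move has been carried out, so that the potential has grown, or nothing has changed
because none of the moves in `A` is improving. -/
def RoundInv (f : Finset (Fin n) → ℝ) (M : Matroid (Fin n)) (W : ℝ) (ℓ C : ℕ)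
    (x₀ : ℕ → Finset (Fin n)) (A : ℕ → ℕ → ℕ → Prop) (s : State n) : Prop :=
  ∃ x, Rep W ℓ x s ∧ IsConfig M ℓ x ∧
    (¬ LocalOpt f M W ℓ C x₀ ∧ n * C * potential f ℓ x₀ + W < n * C * potential f ℓ x ∨
      x = x₀ ∧ ∀ u v : Fin n, ∀ j < ℓ, A u v j → ¬ Improving f M W ℓ C x₀ u v j)

theorem RoundInv.mono {W : ℝ} {ℓ C : ℕ} {x₀ : ℕ → Finset (Fin n)} {A B : ℕ → ℕ → ℕ → Prop}
    {s s' : State n} (h : RoundInv f M W ℓ C x₀ A s) (hset : s'.set = s.set)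
    (hreal : s'.real = s.real) (hAB : ∀ u v : Fin n, ∀ j < ℓ, B u v j → A u v j) :
    RoundInv f M W ℓ C x₀ B s' := by
  obtain ⟨x, hr, hc, h⟩ := h
  exact ⟨x, hr.of_eq (fun k _ => by rw [hset]) (by rw [hreal]), hc,
    h.imp_right fun h => ⟨h.1, fun u v j hj hB => h.2 u v j hj (hAB u v j hj hB)⟩⟩

theorem RoundInv.tryCode {W : ℝ} (hW : 0 ≤ W) {ℓ C : ℕ} {x₀ : ℕ → Finset (Fin n)}
    {A : ℕ → ℕ → ℕ → Prop} {s : State n} (h : RoundInv f M W ℓ C x₀ A s) {u v : Fin n}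
    (hu : s.nat 2 = u) (hv : s.nat 3 = v) {j : ℕ} (hj : j < ℓ) :
    RoundInv f M W ℓ C x₀ (fun u' v' j' => A u' v' j' ∨ u' = u ∧ v' = v ∧ j' = j)
      (run f M (tryCode ℓ C j) s) := by
  classical
  obtain ⟨x, hr, hc, h⟩ := h
  have hrun := run_tryCode (f := f) (M := M) hr hu hv hj C
  by_cases hi : Improving f M W ℓ C x u v j
  · rw [if_pos hi] at hrun
    refine ⟨_, hrun, hc.move hi.1 hj, Or.inl ?_⟩
    have h1 := hi.2
    rw [potential_move hi.1 hj]
    rcases h with ⟨h2, h⟩ | ⟨rfl, -⟩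
    · exact ⟨h2, by linarith⟩
    · exact ⟨fun h2 => h2 u v j hj hi, by linarith⟩
  · rw [if_neg hi] at hrun
    refine ⟨x, hrun, hc, h.imp_right ?_⟩
    rintro ⟨rfl, h⟩
    refine ⟨rfl, fun u' v' j' hj' hA => ?_⟩
    rcases hA with hA | ⟨h1, h2, rfl⟩
    · exact h u' v' j' hj' hA
    · rwa [Fin.ext h1, Fin.ext h2]

/-- A round either increases the potential or ends in a local optimum. -/
theorem run_roundCode {W : ℝ} (hW : 0 ≤ W) {ℓ : ℕ} (C : ℕ) {x : ℕ → Finset (Fin n)} {s : State n}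
    (hr : Rep W ℓ x s) (hc : IsConfig M ℓ x) :
    RoundInv f M W ℓ C x (fun _ _ _ => True) (run f M (roundCode ℓ C) s) := by
  have h1 := forN_induction (f := f) (M := M) (i := 2)
    (c := forN 3 (block ((range ℓ).toList.map (tryCode ℓ C)))) (by decide)
    ⟨by decide, by decide, keeps_try_block (by decide) (by decide)⟩
    (fun k s => RoundInv f M W ℓ C x (fun u _ _ => u < k) s) (s := s)
    ⟨x, hr.of_eq (fun _ _ => rfl) rfl, hc, Or.inr ⟨rfl, by simp⟩⟩ (by
    intro k hk s hs hinv
    have h2 := forN_induction (f := f) (M := M) (i := 3)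
      (c := block ((range ℓ).toList.map (tryCode ℓ C))) (by decide)
      (keeps_try_block (by decide) (by decide))
      (fun m s => s.nat 2 = k ∧
        RoundInv f M W ℓ C x (fun u v _ => u < k ∨ u = k ∧ v < m) s) (s := s)
      ⟨by simp [reset, State.putNat, Addr.eval, hs], hinv.mono rfl rfl (by simp)⟩ (by
      rintro m hm s hs3 ⟨hs2, hinv⟩
      have h3 := block_induction (f := f) (M := M) (range ℓ) (tryCode ℓ C)
        (fun B s => s.nat 2 = k ∧ s.nat 3 = m ∧ RoundInv f M W ℓ C x
          (fun u v j => (u < k ∨ u = k ∧ v < m) ∨ u = k ∧ v = m ∧ j ∈ B) s) (s := s)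
        ⟨hs2, hs3, hinv.mono rfl rfl (by simp)⟩ (by
        rintro B j hj _ s ⟨hs2, hs3, hinv⟩
        refine ⟨(run_nat _ (keeps_tryCode (by decide) (by decide)) s).trans hs2,
          (run_nat _ (keeps_tryCode (by decide) (by decide)) s).trans hs3, ?_⟩
        refine (hinv.tryCode hW (u := ⟨k, hk⟩) (v := ⟨m, hm⟩) hs2 hs3 (mem_range.1 hj)).mono
          rfl rfl ?_
        intro u v j' _ hB
        rw [mem_insert] at hB
        tauto)
      refine ⟨by simp [incr, State.putNat, Addr.eval, h3.1], h3.2.2.mono rfl rfl ?_⟩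
      intro u v j hj hB
      rw [mem_range]
      simp only [hj, and_true]
      omega)
    refine h2.2.mono rfl rfl ?_
    intro u v j _ hB
    have := v.2
    omega)
  exact h1.mono rfl rfl fun u _ _ _ _ => u.2

theorem rep_induction {m : ℕ} {c : Code} (I : ℕ → State n → Prop) {s : State n} (h0 : I 0 s)
    (hstep : ∀ k s, I k s → I (k + 1) (run f M c s)) : I m (run f M (rep m c) s) := by
  have key : ∀ m a s, I a s → I (a + m) (run f M (rep m c) s) := by
    intro m
    induction m with
    | zero => intro a s h; exact h
    | succ m ih =>
      intro a s h
      have := ih (a + 1) _ (hstep a s h)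
      rwa [add_assoc, add_comm 1 m] at this
  simpa using key m 0 s h0

/-- The invariant after `k` rounds: each round has increased the potential by more than `W / (n * C)`,
unless a local optimum has been reached, which no further round changes. -/
def SearchInv (f : Finset (Fin n) → ℝ) (M : Matroid (Fin n)) (W : ℝ) (ℓ C k : ℕ)
    (s : State n) : Prop :=
  ∃ x, Rep W ℓ x s ∧ IsConfig M ℓ x ∧
    (k = 0 ∨ k * W < n * C * potential f ℓ x ∨ LocalOpt f M W ℓ C x)

theorem SearchInv.roundCode {W : ℝ} (hW : 0 ≤ W) {ℓ C k : ℕ} {s : State n}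
    (hpot : ∀ x, 0 ≤ potential f ℓ x) (h : SearchInv f M W ℓ C k s) :
    SearchInv f M W ℓ C (k + 1) (run f M (roundCode ℓ C) s) := by
  obtain ⟨x, hr, hc, h⟩ := h
  obtain ⟨y, hr', hc', h'⟩ := run_roundCode (f := f) hW C hr hc
  refine ⟨y, hr', hc', Or.inr ?_⟩
  rcases h' with ⟨h2, h'⟩ | ⟨rfl, h'⟩
  · rcases h with rfl | h | h
    · left
      have := hpot x
      have : 0 ≤ n * C * potential f ℓ x := by positivity
      push_cast; linarith
    · left; push_cast; linarith
    · exact absurd h h2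
  · exact Or.inr fun u v j hj => h' u v j hj trivial

/-- The number of rounds is `D * n ^ 2`. -/
theorem SearchInv.repeat_round {W : ℝ} (hW : 0 ≤ W) {ℓ C D : ℕ} {s : State n}
    (hpot : ∀ x, 0 ≤ potential f ℓ x) (h : SearchInv f M W ℓ C 0 s) :
    SearchInv f M W ℓ C (D * (n * n)) (run f M (rep D (forN 5 (forN 6 (Code.roundCode ℓ C)))) s) := by
  have hmono : ∀ {k} {s s' : State n}, SearchInv f M W ℓ C k s → s'.set = s.set →
      s'.real = s.real → SearchInv f M W ℓ C k s' := by
    rintro k s s' ⟨x, hr, h⟩ h1 h2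
    exact ⟨x, hr.of_eq (fun k _ => by rw [h1]) (by rw [h2]), h⟩
  have hkeep : ∀ k, k = 5 ∨ k = 6 → (Code.roundCode ℓ C).Keeps k := fun k hk =>
    keeps_roundCode (by omega) (by omega) (by omega) (by omega)
  refine rep_induction (fun d s => SearchInv f M W ℓ C (d * (n * n)) s) (by simpa using h) ?_
  intro d s hd
  have h1 := forN_induction (f := f) (M := M) (i := 5) (c := forN 6 (Code.roundCode ℓ C)) (by decide)
    ⟨by decide, by decide, hkeep 5 (by simp)⟩
    (fun a s => SearchInv f M W ℓ C (d * (n * n) + a * n) s) (s := s)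
    (by simpa using hmono (s' := reset 5 s) hd rfl rfl) (by
    intro a _ s _ ha
    have h2 := forN_induction (f := f) (M := M) (i := 6) (c := Code.roundCode ℓ C) (by decide)
      (hkeep 6 (by simp)) (fun b s => SearchInv f M W ℓ C (d * (n * n) + a * n + b) s) (s := s)
      (by simpa using hmono (s' := reset 6 s) ha rfl rfl)
      (fun b _ s _ hb => hmono (hb.roundCode hW hpot) rfl rfl)
    have h3 := hmono (s' := incr 5 _) h2 rfl rfl
    rwa [add_mul, one_mul, ← add_assoc])
  rwa [add_mul, one_mul]

/-- What `initCode` has achieved after treating the first `k` elements. -/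
structure InitInv (f : Finset (Fin n) → ℝ) (M : Matroid (Fin n)) (k : ℕ) (s : State n) : Prop where
  ground : s.set 1 = univ.filter fun e : Fin n => (e : ℕ) < k
  parts : s.set 4 = s.set 0
  empty : s.set 3 = ∅ ∧ ∀ i, s.set (5 + i) = ∅
  zero : s.real 4 = 0
  indep : M.Indep (s.set 0 : Set (Fin n))
  maximal : ∀ e : Fin n, (e : ℕ) < k → e ∉ s.set 0 → ¬ M.Indep (insert e (s.set 0) : Finset (Fin n))
  best_nonneg : 0 ≤ s.real 0
  le_best : ∀ e : Fin n, (e : ℕ) < k → M.Indep ({e} : Set (Fin n)) → f {e} ≤ s.real 0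
  best_attained : s.real 0 = 0 ∨ ∃ e : Fin n, M.Indep ({e} : Set (Fin n)) ∧ s.real 0 = f {e}

theorem InitInv.of_eq {k : ℕ} {s s' : State n} (h : InitInv f M k s) (h1 : s'.set = s.set)
    (h2 : s'.real = s.real) : InitInv f M k s' := by
  obtain ⟨a1, a2, a3, a4, a5, a6, a7, a8, a9⟩ := h
  constructor <;> first | rwa [h1] | rwa [h2]

theorem InitInv.incr {k i : ℕ} {s : State n} (h : InitInv f M k s) : InitInv f M k (incr i s) :=
  h.of_eq rfl rfl

theorem run_initCode : InitInv f M n (run f M initCode (State.init n)) := by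
  refine forN_induction (by decide) (by simp [Keeps, block]) (InitInv f M) ?_ ?_
  · constructor <;> simp [reset, State.init, State.putNat]
  rintro k hk s hs ⟨a1, a2, a3, a4, a5, a6, a7, a8, a9⟩
  refine InitInv.incr ?_
  have hnat : elems n (s.nat 2) = {⟨k, hk⟩} := by rw [hs]; exact elems_val ⟨k, hk⟩
  have hlt : ∀ {e : Fin n}, (e : ℕ) < k + 1 → (e : ℕ) < k ∨ e = ⟨k, hk⟩ := by
    intro e he
    rcases Nat.lt_succ_iff_lt_or_eq.1 he with h | h
    exacts [Or.inl h, Or.inr (Fin.ext h)]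
  simp only [run_block_cons, run_block_nil, run_instr]
  -- `s₁`: the ground set is extended, and the scratch cell holds the singleton of the element `k`.
  set s₁ := Instr.apply f (Instr.apply f (Instr.apply f s (.setInsert (.dir 1) (.dir 2)))
    (.setUnion (.dir 2) (.dir 3) (.dir 3))) (.setInsert (.dir 2) (.dir 2)) with hs₁
  have b1 : s₁.set 2 = {⟨k, hk⟩} := by
    simp [hs₁, Instr.apply, State.putSet, State.getSet, State.getNat, Addr.eval, hnat, a3.1]
  have b2 : s₁.set 1 = univ.filter fun e : Fin n => (e : ℕ) < k + 1 := by
    simp only [hs₁, Instr.apply, State.putSet, State.getSet, State.getNat, Addr.eval, hnat, a1]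
    ext e
    simp [Fin.ext_iff]; omega
  have b3 : ∀ i, i ≠ 1 → i ≠ 2 → s₁.set i = s.set i := by
    intro i h1 h2
    simp [hs₁, Instr.apply, State.putSet, Addr.eval, h1, h2]
  have b4 : s₁.real = s.real := rfl
  have b5 : s₁.nat = s.nat := rfl
  have b6 : Test.Holds M s₁ (.indep (.dir 2)) ↔ M.Indep ({⟨k, hk⟩} : Set (Fin n)) := by
    simp [Test.Holds, State.getSet, Addr.eval, b1]
  clear_value s₁
  generalize hs₂ : run f M (ite (.indep (.dir 2)) (seq (instr (.value (.dir 1) (.dir 2)))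
      (ite (.realLt (.dir 0) (.dir 1)) (instr (.realAdd (.dir 0) (.dir 1) (.dir 4))) skip)) skip)
      s₁ = s₂
  have c1 : s₂.set = s₁.set ∧ s₂.nat = s₁.nat ∧ s₂.real 4 = 0 ∧ 0 ≤ s₂.real 0 ∧
      (∀ e : Fin n, (e : ℕ) < k + 1 → M.Indep ({e} : Set (Fin n)) → f {e} ≤ s₂.real 0) ∧
      (s₂.real 0 = 0 ∨ ∃ e : Fin n, M.Indep ({e} : Set (Fin n)) ∧ s₂.real 0 = f {e}) := by
    rw [← b4] at a4 a7 a8 a9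
    by_cases hI : M.Indep ({⟨k, hk⟩} : Set (Fin n))
    · rw [run_ite_pos (b6.2 hI), run_seq, run_instr] at hs₂
      set s₃ := Instr.apply f s₁ (.value (.dir 1) (.dir 2)) with hs₃
      have d1 : s₃.real 1 = f {⟨k, hk⟩} := by
        simp [hs₃, Instr.apply, State.putReal, State.getSet, Addr.eval, b1]
      have d2 : ∀ i ≠ 1, s₃.real i = s₁.real i := by
        intro i hi
        simp [hs₃, Instr.apply, State.putReal, Addr.eval, hi]
      have d3 : Test.Holds M s₃ (.realLt (.dir 0) (.dir 1)) ↔ s₁.real 0 < f {⟨k, hk⟩} := by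
        simp [Test.Holds, State.getReal, Addr.eval, d1, d2]
      by_cases hW : s₁.real 0 < f {⟨k, hk⟩}
      · rw [run_ite_pos (d3.2 hW), run_instr] at hs₂
        have d4 : s₂.real 0 = f {⟨k, hk⟩} := by
          simp [← hs₂, Instr.apply, State.putReal, State.getReal, Addr.eval, d1, d2, a4]
        refine ⟨by rw [← hs₂]; rfl, by rw [← hs₂]; rfl, ?_, ?_, ?_, Or.inr ⟨_, hI, d4⟩⟩
        · simp [← hs₂, Instr.apply, State.putReal, Addr.eval, d2, a4]
        · rw [d4]; linarith
        · intro e he hIe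
          rw [d4]
          rcases hlt he with he | rfl
          · linarith [a8 e he hIe]
          · exact le_rfl
      · rw [run_ite_neg (d3.not.2 hW), run_skip] at hs₂
        subst hs₂
        rw [d2 4 (by decide), d2 0 (by decide)]
        refine ⟨rfl, rfl, a4, a7, fun e he hIe => ?_, a9⟩
        rcases hlt he with he | rfl
        · exact a8 e he hIe
        · exact not_lt.1 hW
    · rw [run_ite_neg (b6.not.2 hI), run_skip] at hs₂
      subst hs₂
      refine ⟨rfl, rfl, a4, a7, fun e he hIe => ?_, a9⟩
      rcases hlt he with he | rfl
      · exact a8 e he hIe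
      · exact absurd hIe hI
  clear hs₂
  obtain ⟨c1, c2, c3, c4, c5, c6⟩ := c1
  rw [b5] at c2
  -- `s₄`: the scratch cell holds the current set together with the element `k`.
  set s₄ := Instr.apply f (Instr.apply f s₂ (.setUnion (.dir 2) (.dir 0) (.dir 3)))
    (.setInsert (.dir 2) (.dir 2)) with hs₄
  have e1 : s₄.set 2 = insert ⟨k, hk⟩ (s.set 0) := by
    simp [hs₄, Instr.apply, State.putSet, State.getSet, State.getNat, Addr.eval, hnat, c1, c2, a3.1,
      b3, union_comm _ {_}]
  have e2 : ∀ i, i ≠ 1 → i ≠ 2 → s₄.set i = s.set i := by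
    intro i h1 h2
    simp [hs₄, Instr.apply, State.putSet, Addr.eval, h2, c1, b3 i h1 h2]
  have e3 : s₄.set 1 = univ.filter fun e : Fin n => (e : ℕ) < k + 1 := by
    simp [hs₄, Instr.apply, State.putSet, Addr.eval, c1, b2]
  have e4 : s₄.real = s₂.real := rfl
  have e5 : s₄.nat = s.nat := c2
  have e6 : Test.Holds M s₄ (.indep (.dir 2)) ↔
      M.Indep (insert ⟨k, hk⟩ (s.set 0) : Finset (Fin n)) := by
    simp only [Test.Holds, State.getSet, Addr.eval, e1]
  clear_value s₄
  by_cases hI : M.Indep (insert ⟨k, hk⟩ (s.set 0) : Finset (Fin n))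
  · rw [run_ite_pos (e6.2 hI), run_seq, run_instr, run_instr]
    set s₅ := Instr.apply f (Instr.apply f s₄ (.setInsert (.dir 0) (.dir 2)))
      (.setInsert (.dir 4) (.dir 2)) with hs₅
    have g1 : s₅.set 0 = insert ⟨k, hk⟩ (s.set 0) := by
      simp [hs₅, Instr.apply, State.putSet, State.getSet, State.getNat, Addr.eval, hnat, e2, e5,
        union_comm _ {_}]
    have g2 : s₅.set 4 = insert ⟨k, hk⟩ (s.set 0) := by
      simp [hs₅, Instr.apply, State.putSet, State.getSet, State.getNat, Addr.eval, hnat, e2, e5,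
        a2, union_comm _ {_}]
    have g3 : ∀ i, i ≠ 0 → i ≠ 4 → s₅.set i = s₄.set i := by
      intro i h1 h2
      simp [hs₅, Instr.apply, State.putSet, Addr.eval, h1, h2]
    have g4 : s₅.real = s₂.real := e4
    clear_value s₅
    constructor
    · rw [g3 1 (by decide) (by decide), e3]
    · rw [g1, g2]
    · refine ⟨by rw [g3 3 (by decide) (by decide), e2 3 (by decide) (by decide), a3.1], fun i => ?_⟩
      rw [g3 _ (by omega) (by omega), e2 _ (by omega) (by omega), a3.2]
    · rw [g4, c3]
    · rwa [g1]
    · intro e he hne hIe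
      rw [g1] at hne hIe
      rw [mem_insert, not_or] at hne
      rcases hlt he with he | he
      · exact a6 e he hne.2 (hIe.subset (by
          exact_mod_cast insert_subset_insert e (subset_insert _ _)))
      · exact hne.1 he
    · rwa [g4]
    · rwa [g4]
    · rwa [g4]
  · rw [run_ite_neg (e6.not.2 hI), run_skip]
    have e0 := e2 0 (by decide) (by decide)
    constructor
    · exact e3
    · rw [e0, e2 4 (by decide) (by decide), a2]
    · exact ⟨by rw [e2 3 (by decide) (by decide), a3.1],
        fun i => by rw [e2 _ (by omega) (by omega), a3.2]⟩
    · rw [e4, c3]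
    · rwa [e0]
    · intro e he hne hIe
      rw [e0] at hne hIe
      rcases hlt he with he | rfl
      · exact a6 e he hne hIe
      · exact hI hIe
    · rwa [e4]
    · rwa [e4]
    · rwa [e4]

theorem InitInv.searchInv {s : State n} (h : InitInv f M n s) {ℓ : ℕ}
    (hl : 0 < ℓ) (C : ℕ) : SearchInv f M (s.real 0) ℓ C 0 s := by
  have hun : ((range ℓ).biUnion fun i => s.set (4 + i)) = s.set 0 := by
    ext e
    rw [mem_biUnion]
    constructor
    · rintro ⟨i, _, he⟩
      rcases i with _ | i
      · rwa [← h.parts]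
      · rw [show 4 + (i + 1) = 5 + i by omega, h.empty.2] at he
        simp at he
    · intro he
      exact ⟨0, mem_range.2 hl, by simpa [h.parts] using he⟩
  refine ⟨fun i => s.set (4 + i), ⟨hun.symm, ?_, h.empty.1, fun _ _ => rfl, rfl⟩, ⟨?_, ?_⟩, Or.inl rfl⟩
  · rw [h.ground]; ext e; simp
  · intro a _ b _ hab
    have hempty : ∀ i ≠ 0, s.set (4 + i) = ∅ := by
      intro i hi
      rw [show 4 + i = 5 + (i - 1) by omega, h.empty.2]
    simp only [Function.onFun]
    by_cases ha : a = 0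
    · rw [hempty b (fun hb => hab (ha.trans hb.symm))]; exact disjoint_empty_right _
    · rw [hempty a ha]; exact disjoint_empty_left _
  · rw [hun]
    refine h.indep.isBase_of_forall_insert fun e he => ?_
    simpa using h.maximal e e.2 he.2

end Code

/-! ### Curvature -/

section Curvature

variable {E : Type*} [DecidableEq E] {f : Finset E → ℝ}

theorem curvature_mem_Icc (hf : IsSubmodular f) (hm : Monotone f) (h0 : 0 ≤ f ∅) :
    curvature f ∈ Set.Icc 0 1 := by
  constructor
  · refine Real.sSup_nonneg ?_
    rintro _ ⟨S, e, _, hpos, rfl⟩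
    have := hf.insert_sub_le hm (empty_subset S) e
    rw [insert_empty] at this
    rw [sub_nonneg, div_le_one hpos]
    linarith
  · refine Real.sSup_le ?_ zero_le_one
    rintro _ ⟨S, e, _, hpos, rfl⟩
    have := div_nonneg (sub_nonneg.2 (hm (subset_insert e S))) hpos.le
    linarith

variable [Fintype E]

theorem mul_singleton_le_lin (hm : Monotone f) (h0 : ∀ S, 0 ≤ f S) (e : E) :
    (1 - curvature f) * f {e} ≤ lin f e := by
  rcases (h0 {e}).eq_or_lt with h | h
  · rw [← h, mul_zero]; exact lin_nonneg hm e
  · have hle : 1 - lin f e / f {e} ≤ curvature f := by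
      refine le_csSup ⟨1, ?_⟩ ⟨univ.erase e, e, notMem_erase _ _, h, ?_⟩
      · rintro _ ⟨S, e, _, hpos, rfl⟩
        have := div_nonneg (sub_nonneg.2 (hm (subset_insert e S))) hpos.le
        linarith
      · rw [insert_erase (mem_univ _), lin]
    rw [← le_div_iff₀ h]
    linarith

/-- The linear part of `f` accounts for a fraction of at least `1 - κ_f` of each value. -/
theorem mul_le_sum_lin (hf : IsSubmodular f) (hm : Monotone f) (h0 : ∀ S, 0 ≤ f S) {T : Finset E}
    (hT : T.Nonempty) : (1 - curvature f) * f T ≤ ∑ e ∈ T, lin f e := by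
  have h1 := (curvature_mem_Icc hf hm (h0 ∅)).2
  calc (1 - curvature f) * f T ≤ (1 - curvature f) * ∑ e ∈ T, f {e} :=
        mul_le_mul_of_nonneg_left (hf.le_sum_singleton hm (h0 ∅) hT) (by linarith)
    _ ≤ _ := by
        rw [mul_sum]
        exact sum_le_sum fun e _ => mul_singleton_le_lin hm h0 e

end Curvature

/-! ### The approximation ratio -/

section Ratio

variable {E : Type*} [DecidableEq E] [Fintype E] {f : Finset E → ℝ}

theorem potential_nonneg (hm : Monotone f) (h0 : ∀ S, 0 ≤ f S) (ℓ : ℕ) (x : ℕ → Finset E) :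
    0 ≤ potential f ℓ x :=
  add_nonneg (sum_nonneg fun _ _ => mul_nonneg (Nat.cast_nonneg _) (h0 _))
    (mul_nonneg (Nat.cast_nonneg _) (sum_nonneg fun e _ => lin_nonneg hm e))

/-- The sum of all coefficients in the potential. -/
def totalWeight (ℓ : ℕ) : ℕ := ∑ J ∈ (range ℓ).powerset, weight ℓ #J + linWeight ℓ

theorem totalWeight_pos {ℓ : ℕ} (hl : 0 < ℓ) : 0 < totalWeight ℓ :=
  Nat.add_pos_right _ (by unfold linWeight; positivity)

theorem potential_le (hf : IsSubmodular f) (hm : Monotone f) (h0 : ∀ S, 0 ≤ f S) {ℓ : ℕ}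
    {x : ℕ → Finset E} (hne : ((range ℓ).biUnion x).Nonempty) {W : ℝ}
    (hW : ∀ e ∈ (range ℓ).biUnion x, f {e} ≤ W) :
    potential f ℓ x ≤ totalWeight ℓ * (Fintype.card E * W) := by
  have hW0 : 0 ≤ W := by
    obtain ⟨e, he⟩ := hne
    exact (h0 _).trans (hW e he)
  have h1 : ∑ e ∈ (range ℓ).biUnion x, f {e} ≤ Fintype.card E * W := by
    calc _ ≤ ∑ e ∈ (range ℓ).biUnion x, W := sum_le_sum hW
      _ = #((range ℓ).biUnion x) * W := by rw [sum_const, nsmul_eq_mul]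
      _ ≤ _ := mul_le_mul_of_nonneg_right (by exact_mod_cast card_le_univ _) hW0
  have h2 : ∀ J ∈ (range ℓ).powerset, (weight ℓ #J : ℝ) * f (J.biUnion x) ≤
      weight ℓ #J * (Fintype.card E * W) := fun J hJ =>
    mul_le_mul_of_nonneg_left ((hm (biUnion_subset_biUnion_of_subset_left _ (mem_powerset.1 hJ))).trans
      ((hf.le_sum_singleton hm (h0 ∅) hne).trans h1)) (Nat.cast_nonneg _)
  have h3 : ∑ e ∈ (range ℓ).biUnion x, lin f e ≤ Fintype.card E * W := by
    refine (sum_le_sum fun e _ => ?_).trans h1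
    have := lin_le hf hm (notMem_empty e)
    rw [insert_empty] at this
    linarith [h0 ∅]
  have h4 := sum_le_sum h2
  rw [← sum_mul] at h4
  have h5 := mul_le_mul_of_nonneg_left h3 (Nat.cast_nonneg (α := ℝ) (linWeight ℓ))
  simp only [potential, totalWeight, Nat.cast_add, Nat.cast_sum, add_mul]
  linarith

theorem linWeight_div_topWeight {ℓ : ℕ} (hl : 0 < ℓ) :
    (ℓ * linWeight ℓ : ℝ) / topWeight ℓ = ((1 + 1 / (ℓ : ℝ)) ^ ℓ)⁻¹ := by
  have h1 : (ℓ : ℝ) ≠ 0 := by positivity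
  have h2 : ((ℓ - 1).factorial : ℝ) ≠ 0 := by positivity
  rw [one_add_div h1, div_pow, inv_div]
  simp only [linWeight, topWeight, Nat.cast_mul, Nat.cast_pow, Nat.cast_add, Nat.cast_one]
  have h3 : (ℓ + 1 : ℝ) ^ ℓ ≠ 0 := by positivity
  field_simp

theorem exists_ratio_le {δ : ℝ} (hδ : 0 < δ) :
    ∃ ℓ : ℕ, 0 < ℓ ∧ (ℓ * linWeight ℓ : ℝ) / topWeight ℓ ≤ 1 / Real.exp 1 + δ := by
  have h := (Real.tendsto_one_add_div_pow_exp 1).inv₀ (Real.exp_ne_zero 1)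
  rw [← one_div] at h
  obtain ⟨ℓ, h1, h2⟩ := ((h.eventually (ge_mem_nhds (lt_add_of_pos_right _ hδ))).and
    (Filter.eventually_gt_atTop 0)).exists
  exact ⟨ℓ, h2, (linWeight_div_topWeight h2).trans_le h1⟩

/-- The guarantee of `local_optimum` in terms of the curvature. -/
theorem local_optimum_ratio {M : Matroid E} (hE : M.E = Set.univ) {ℓ : ℕ} (hl : 0 < ℓ)
    (hf : IsSubmodular f) (hm : Monotone f) (h0 : ∀ S, 0 ≤ f S) {x : ℕ → Finset E}
    (hx : IsConfig M ℓ x) {η W : ℝ} (hW : 0 ≤ W)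
    (hη : (ℓ * linWeight ℓ : ℝ) / topWeight ℓ ≤ 1 / Real.exp 1 + η) {C : ℕ} (hC : 0 < C)
    (hCη : 1 / (C : ℝ) ≤ η) (hopt : ∀ u v, ∀ j < ℓ, Feasible M ℓ x u v →
      Fintype.card E * (C * gain f ℓ x u v j) ≤ W)
    {T : Finset E} (hT : M.Indep (T : Set E)) (hTne : T.Nonempty) :
    (1 - curvature f / Real.exp 1 - η) * f T ≤ f ((range ℓ).biUnion x) + η * W := by
  have hn : (0 : ℝ) < Fintype.card E := by
    obtain ⟨e, _⟩ := hTne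
    exact_mod_cast Fintype.card_pos_iff.2 ⟨e⟩
  have hC' : (0 : ℝ) < C := by exact_mod_cast hC
  have hl' : (0 : ℝ) < ℓ := by exact_mod_cast hl
  have hQl : (ℓ : ℝ) ≤ topWeight ℓ := by
    have : 0 < (ℓ + 1) ^ ℓ * (ℓ - 1).factorial := by positivity
    exact_mod_cast (Nat.le_mul_of_pos_right ℓ this).trans_eq (mul_assoc _ _ _).symm
  have hQ : (0 : ℝ) < topWeight ℓ := hl'.trans_le hQl
  have h1 := local_optimum hE hl hf hm h0 hx (δ := W / (Fintype.card E * C)) (by positivity)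
    (fun u v j hj hF => by
      rw [le_div_iff₀ (by positivity)]
      linarith [hopt u v j hj hF]) hT
  have h2 := mul_le_sum_lin hf hm h0 hTne
  obtain ⟨hκ0, hκ1⟩ := curvature_mem_Icc hf hm (h0 ∅)
  set κ := curvature f
  set ρ := (ℓ * linWeight ℓ : ℝ) / topWeight ℓ with hρ
  have hρ0 : 0 ≤ ρ := by positivity
  have e1 : (ℓ * linWeight ℓ : ℝ) = topWeight ℓ * ρ := by rw [hρ]; field_simp
  have e2 : Fintype.card E * ℓ * (W / (Fintype.card E * C)) = ℓ * (1 / C * W) := by field_simp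
  rw [e1, e2] at h1
  have hη0 : 0 ≤ η := le_trans (by positivity) hCη
  have h3 : ℓ * (1 / C * W) ≤ topWeight ℓ * (η * W) := by gcongr
  have h4 : (1 - ρ) * f T + ρ * ∑ e ∈ T, lin f e ≤ f ((range ℓ).biUnion x) + η * W := by
    refine le_of_mul_le_mul_left ?_ hQ
    linarith
  have h5 : ρ * ((1 - κ) * f T) ≤ ρ * ∑ e ∈ T, lin f e := mul_le_mul_of_nonneg_left h2 hρ0
  have h6 : ρ * κ ≤ κ / Real.exp 1 + η := by
    calc ρ * κ ≤ (1 / Real.exp 1 + η) * κ := mul_le_mul_of_nonneg_right hη hκ0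
      _ = κ / Real.exp 1 + η * κ := by ring
      _ ≤ _ := by nlinarith
  have h7 := mul_le_mul_of_nonneg_right h6 (h0 T)
  linarith

end Ratio

end OracleMax

theorem theorem1 (ε : ℝ) (hε : 0 < ε) :
    ∃ (P : OracleMax.Program) (p : Polynomial ℕ),
      ∀ (n : ℕ) (M : Matroid (Fin n)) (f : Finset (Fin n) → ℝ),
        M.E = Set.univ → (∀ S, 0 ≤ f S) → Monotone f → OracleMax.IsSubmodular f →
        ∃ (t : ℕ) (s : OracleMax.State n),
          OracleMax.Exec f M P (OracleMax.State.init n) t s ∧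
          t ≤ p.eval n ∧
          M.Indep (s.output : Set (Fin n)) ∧
          ∀ T : Finset (Fin n), M.Indep (T : Set (Fin n)) →
            (1 - OracleMax.curvature f / Real.exp 1 - ε) * f T ≤ f s.output := by
  obtain ⟨ℓ, hl, hratio⟩ := OracleMax.exists_ratio_le (half_pos hε)
  obtain ⟨C, hC⟩ := exists_nat_one_div_lt (half_pos hε)
  let c := OracleMax.Code.mainCode ℓ (C + 1) ((C + 1) * OracleMax.totalWeight ℓ)
  refine ⟨c.compile, c.time, fun n M f hE h0 hm hf => ?_⟩
  obtain ⟨t, ht, hexec⟩ := OracleMax.Code.exec_compile (f := f) (M := M) c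
    OracleMax.Code.wellFormed_mainCode (OracleMax.State.init n) (by simp [OracleMax.State.init])
  refine ⟨t, _, hexec, ht, ?_⟩
  have hinit := OracleMax.Code.run_initCode (f := f) (M := M)
  obtain ⟨x, hr, hx, hopt⟩ := (hinit.searchInv hl (C + 1)).repeat_round
    (D := (C + 1) * OracleMax.totalWeight ℓ) hinit.best_nonneg
    (OracleMax.potential_nonneg hm h0 ℓ)
  have hout : (OracleMax.Code.run f M c (OracleMax.State.init n)).output =
      (Finset.range ℓ).biUnion x := hr.sol
  set W := (OracleMax.Code.run f M OracleMax.Code.initCode (OracleMax.State.init n)).real 0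
  rw [hout]
  refine ⟨hx.isBase.indep, fun T hT => ?_⟩
  obtain ⟨hκ0, hκ1⟩ := OracleMax.curvature_mem_Icc hf hm (h0 ∅)
  have hκe : 0 ≤ OracleMax.curvature f / Real.exp 1 := by positivity
  rcases T.eq_empty_or_nonempty with rfl | hTne
  · have := hm (Finset.empty_subset ((Finset.range ℓ).biUnion x))
    nlinarith [h0 ∅, mul_nonneg (add_nonneg hκe hε.le) (h0 ∅)]
  have hn : 0 < n := by
    obtain ⟨e, _⟩ := hTne
    exact e.pos
  have hSne : ((Finset.range ℓ).biUnion x).Nonempty := by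
    rw [Finset.nonempty_iff_ne_empty]
    intro h
    have hb := hx.isBase
    rw [h] at hb
    have := hb.eq_of_subset_indep hT (by simp)
    simp only [Finset.coe_empty] at this
    exact hTne.ne_empty (by exact_mod_cast this.symm)
  -- The potential is too small for all the rounds to have increased it.
  have hloc : OracleMax.Code.LocalOpt f M W ℓ (C + 1) x := by
    rcases hopt with h | h | h
    · have := OracleMax.totalWeight_pos hl
      have : 0 < (C + 1) * OracleMax.totalWeight ℓ * (n * n) := by positivity
      omega
    · have hle := OracleMax.potential_le hf hm h0 hSne (W := W) fun e he =>
        hinit.le_best e e.2 (hx.isBase.indep.subset (by simpa using he))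
      rw [Fintype.card_fin] at hle
      have := mul_le_mul_of_nonneg_left hle
        (show (0 : ℝ) ≤ n * ((C + 1 : ℕ) : ℝ) by positivity)
      push_cast at this h
      linarith
    · exact h
  have key : ∀ T : Finset (Fin n), M.Indep (T : Set (Fin n)) → T.Nonempty →
      (1 - OracleMax.curvature f / Real.exp 1 - ε / 2) * f T ≤
        f ((Finset.range ℓ).biUnion x) + ε / 2 * W := fun T hT hTne =>
    OracleMax.local_optimum_ratio hE hl hf hm h0 hx hinit.best_nonneg hratio C.succ_pos
      (by push_cast; exact hC.le) (fun u v j hj hF => by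
        rw [Fintype.card_fin]
        exact not_lt.1 fun hlt => hloc u v j hj ⟨hF, hlt⟩) hT hTne
  have hT1 := key T hT hTne
  by_cases hWT : W ≤ f T
  · nlinarith
  -- Otherwise the singleton of value `W` is better than `T`.
  rcases hinit.best_attained with hW | ⟨e, he, hW⟩
  · exact absurd (hW.trans_le (h0 T)) hWT
  have he1 := key {e} (by simpa using he) (Finset.singleton_nonempty e)
  rw [← hW] at he1
  rcases le_total 0 (1 - OracleMax.curvature f / Real.exp 1 - ε) with h | h
  · have := mul_le_mul_of_nonneg_left (not_le.1 hWT).le h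
    linarith
  · exact (mul_nonpos_of_nonpos_of_nonneg h (h0 T)).trans (h0 _)
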